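/- Fix a relational schema $\Sigma$ (finitely many relation symbols, each of positive arity) and a Boolean UCQ$^{\neg}$ $q$ over $\Sigma$: a finite union of queries $\exists \bar x\,(\alpha_1\wedge\dots\wedge\alpha_n)$ where each $\alpha_i$ is a relational atom, a negated relational atom, or an inequality $t\neq t'$ (terms being constants or variables), and each variable that occurs in a negated atom or an inequality also occurs in a positive atom of the same disjunct. A database $D$ is a finite set of facts (atoms all of whose arguments are constants), and $\mathrm{const}(D)$ is the set of constants occurring in it. Let $D^-$ be the set of facts $R(\bar c)\notin D$ with $R\in\Sigma$ and all entries of $\bar c$ in $\mathrm{const}(D)$. Let $q^{\pm}$ be the query over the signed schema $\{+R,-R : R\in\Sigma\}$ obtained from $q$ by replacing each positive atom $R(\bar t)$ by $+R(\bar t)$ and each negated atom $\neg R(\bar t)$ by $-R(\bar t)$. A set $S\subseteq D$ is a positive support of $q$ in $D$ if $\{+\alpha : \alpha\in S\}\cup\{-\alpha : \alpha\in D^-\}\models q^{\pm}$; a fact is positive-relevant for $q$ in $D$ if it belongs to some inclusion-minimal positive support of $q$ in $D$. Proposition. For every fixed UCQ$^{\neg}$ $q$, it can be decided in $\mathrm{AC}^0$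 data complexity whether a fact $\alpha\in D$ is positive-relevant for $q$ in $D$, and this can be done through a first-order formula evaluated on $D$. That is: (1) for every relation symbol $R\in\Sigma$, of arity $k$, there is a first-order formula $\varphi_R(y_1,\dots,y_k)$ over $\Sigma$, equality and the constants of $q$, depending only on $q$, such that for every database $D$ and every fact $\alpha=R(c_1,\dots,c_k)\in D$, the sentence $\varphi_R(c_1,\dots,c_k)$, evaluated on $D$ with domain $\mathrm{const}(D)\cup\mathrm{const}(q)$, holds if and only if $\alpha$ is positive-relevant for $q$ in $D$; (2) the problem is in uniform $\mathrm{AC}^0$: take binary words as constants, and represent a pair $(D,\alpha)$ by a word that consists of $\alpha$ followed by a list of the facts of $D$ (in any order, possibly with repetitions), where a fact $R(c_1,\dots,c_k)$ is written as the letter $R$ followed by the words $c_1,\dots,c_k$, each terminated by an end marker. Then the set of all words that represent some $(D,\alpha)$ with $\alpha\in D$ positive-relevant for $q$ in $D$ is decided by a family $(C_n)_{n\ge 0}$ of circuits, $C_n$ reading words of length $n$, with NOT gates, AND and OR gates of unbounded fan-in and input gates testing whether a given position carries a given letter, of size polynomial in $n$ and depth bounded by a constant, which is first-order uniform: the gates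 of $C_n$ can be named by a tag from a finite set and a tuple of fixed length over $\{0,\dots,n\}$ so that the set of gates, their kinds, the wires and the output gate are defined by first-order formulas, independent of $n$, over $\{0,\dots,n\}$ with $\le$, $+$ and $\times$. -/

import Mathlib

/-! ## Databases and queries -/

/-- Constants: the words over a binary alphabet (a countably infinite set of names). -/
abbrev Const : Type := List Bool

/-- Variables. -/
abbrev Var : Type := ℕ

/-- A relational schema: a finite set of relation symbols, each with a positive arity. -/
structure Schema where
  Rel : Type
  finite_rel : Finite Rel
  arity : Rel → ℕ
  arity_pos : ∀ R, 0 < arity R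

/-- Terms are constants or variables. -/
inductive QTerm : Type
  | const (c : Const) : QTerm
  | var (x : Var) : QTerm

/-- The value of a term under a valuation of the variables. -/
def QTerm.eval (ν : Var → Const) : QTerm → Const
  | .const c => c
  | .var x => ν x

/-- Relational atoms `R(t₁, …, tₖ)`. -/
structure Atom (σ : Schema) where
  rel : σ.Rel
  args : Fin (σ.arity rel) → QTerm

/-- Facts: atoms containing only constants. -/
@[ext]
structure DBFact (σ : Schema) where
  rel : σ.Rel
  args : Fin (σ.arity rel) → Const

/-- The fact obtained from an atom by a valuation. -/
def Atom.eval {σ : Schema} (ν : Var → Const) (a : Atom σ) : DBFact σ :=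
  ⟨a.rel, fun i => (a.args i).eval ν⟩

/-- A variable occurs in an atom. -/
def Atom.HasVar {σ : Schema} (a : Atom σ) (x : Var) : Prop := ∃ i, a.args i = .var x

/-- A database is a finite set of facts. -/
abbrev Database (σ : Schema) : Type := Finset (DBFact σ)

/-- The active domain: the constants occurring in a database. -/
def activeDomain {σ : Schema} (D : Database σ) : Set Const :=
  {c | ∃ f ∈ D, ∃ i, f.args i = c}

/-- Boolean conjunctive queries with negated atoms and inequality atoms, all variables being
existentially quantified, subject to safe negation. -/
structure CQNeg (σ : Schema) where
  /-- the positive atoms -/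
  pos : List (Atom σ)
  /-- the atoms that occur negated -/
  neg : List (Atom σ)
  /-- the inequality atoms `t ≠ t'` -/
  ineq : List (QTerm × QTerm)
  safe_neg : ∀ a ∈ neg, ∀ x, a.HasVar x → ∃ b ∈ pos, b.HasVar x
  safe_ineq : ∀ e ∈ ineq, ∀ x, e.1 = .var x ∨ e.2 = .var x → ∃ b ∈ pos, b.HasVar x

/-- Finite unions (disjunctions) of such queries. -/
abbrev UCQNeg (σ : Schema) : Type := List (CQNeg σ)

/-- The valuation `ν` makes the conjunction true on a set of facts. -/
def CQNeg.SatBy {σ : Schema} (F : Set (DBFact σ)) (p : CQNeg σ) (ν : Var → Const) : Prop :=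
  (∀ a ∈ p.pos, a.eval ν ∈ F) ∧ (∀ a ∈ p.neg, a.eval ν ∉ F) ∧
    ∀ e ∈ p.ineq, e.1.eval ν ≠ e.2.eval ν

/-- A Boolean query holds in a set of facts. -/
def UCQNeg.Holds {σ : Schema} (F : Set (DBFact σ)) (q : UCQNeg σ) : Prop :=
  ∃ p ∈ q, ∃ ν : Var → Const, p.SatBy F ν

/-- The constants occurring in a query. -/
def UCQNeg.consts {σ : Schema} (q : UCQNeg σ) : Set Const :=
  {c | ∃ p ∈ q, (∃ a ∈ p.pos, ∃ i, a.args i = .const c) ∨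
    (∃ a ∈ p.neg, ∃ i, a.args i = .const c) ∨
    ∃ e ∈ p.ineq, e.1 = .const c ∨ e.2 = .const c}

/-! ## Signed facts and positive supports -/

/-- The signed schema, with two copies `+R` (left) and `-R` (right) of each symbol `R`. -/
def Schema.signed (σ : Schema) : Schema where
  Rel := σ.Rel ⊕ σ.Rel
  finite_rel := by
    have := σ.finite_rel
    infer_instance
  arity := Sum.elim σ.arity σ.arity
  arity_pos := by
    rintro (R | R)
    · exact σ.arity_pos R
    · exact σ.arity_pos R

/-- The signed atom `+R(t)`. -/
def Atom.plus {σ : Schema} (a : Atom σ) : Atom σ.signed := ⟨Sum.inl a.rel, a.args⟩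

/-- The signed atom `-R(t)`. -/
def Atom.minus {σ : Schema} (a : Atom σ) : Atom σ.signed := ⟨Sum.inr a.rel, a.args⟩

/-- The signed fact `+R(c)`. -/
def DBFact.plus {σ : Schema} (f : DBFact σ) : DBFact σ.signed := ⟨Sum.inl f.rel, f.args⟩

/-- The signed fact `-R(c)`. -/
def DBFact.minus {σ : Schema} (f : DBFact σ) : DBFact σ.signed := ⟨Sum.inr f.rel, f.args⟩

/-- The query over the signed schema in which `R(t)` becomes `+R(t)` and `¬ R(t)` becomes
the non-negated atom `-R(t)`. -/
def CQNeg.signed {σ : Schema} (p : CQNeg σ) : CQNeg σ.signed where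
  pos := p.pos.map Atom.plus ++ p.neg.map Atom.minus
  neg := []
  ineq := p.ineq
  safe_neg := by simp
  safe_ineq := by
    intro e he x hx
    obtain ⟨b, hb, hbx⟩ := p.safe_ineq e he x hx
    exact ⟨b.plus, List.mem_append_left _ (List.mem_map_of_mem hb), hbx⟩

/-- The signed version of a union of conjunctive queries. -/
def UCQNeg.signed {σ : Schema} (q : UCQNeg σ) : UCQNeg σ.signed := List.map CQNeg.signed q

/-- The signed database: `+f` for every fact `f` of `D`, and `-f` for every absent fact `f` over
the active domain of `D`. -/
def signedDatabase {σ : Schema} (D : Database σ) : Set (DBFact σ.signed) :=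
  DBFact.plus '' {f | f ∈ D} ∪ DBFact.minus '' {f | (∀ i, f.args i ∈ activeDomain D) ∧ f ∉ D}

/-- The unsigned facts that appear negatively in a set of signed facts. -/
def negPart {σ : Schema} (F : Set (DBFact σ.signed)) : Set (DBFact σ) := {f | f.minus ∈ F}

/-- `S ⊆ D` is a positive support of `q` in `D` if the positive copy of `S` together with all
negative facts of the signed version of `D` satisfies the signed version of `q`. -/
def IsPositiveSupport {σ : Schema} (q : UCQNeg σ) (D S : Database σ) : Prop :=
  S ⊆ D ∧ q.signed.Holds (DBFact.plus '' {f | f ∈ S} ∪ DBFact.minus '' negPart (signedDatabase D))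

/-- A fact is positive-relevant if it belongs to some inclusion-minimal positive support. -/
def PositiveRelevant {σ : Schema} (q : UCQNeg σ) (D : Database σ) (α : DBFact σ) : Prop :=
  ∃ S : Database σ, Minimal (IsPositiveSupport q D) S ∧ α ∈ S

/-! ## First-order formulas evaluated on a database -/

/-- The first-order language with the relation symbols of `σ` and a constant symbol for each
element of `K`. -/
def schemaLanguage (σ : Schema) (K : Set Const) : FirstOrder.Language where
  Functions n := {_c : K // n = 0}
  Relations n := {R : σ.Rel // σ.arity R = n}

/-- The domain over which formulas are evaluated on `D`: the active domain of `D`, together with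
the named constants. -/
def EvalDomain {σ : Schema} (D : Database σ) (K : Set Const) : Type :=
  {c : Const // c ∈ activeDomain D ∨ c ∈ K}

/-- A database as a first-order structure. -/
instance databaseStructure {σ : Schema} (D : Database σ) (K : Set Const) :
    (schemaLanguage σ K).Structure (EvalDomain D K) where
  funMap f _ := ⟨f.1.1, Or.inr f.1.2⟩
  RelMap R v := (⟨R.1, fun i => (v (Fin.cast R.2 i)).1⟩ : DBFact σ) ∈ D

/-- The arguments of a fact of `D`, as elements of the evaluation domain. -/
def factArgs {σ : Schema} {D : Database σ} (K : Set Const) {α : DBFact σ} (hα : α ∈ D) :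
    Fin (σ.arity α.rel) → EvalDomain D K :=
  fun i => ⟨α.args i, Or.inl ⟨α, hα, i, rfl⟩⟩

/-! ## Boolean circuits and uniform `AC⁰` -/

/-- Kinds of gates of a circuit reading words of length `n` over `Γ`: unbounded fan-in AND and OR,
negation, and input gates testing whether the letter at position `i` is `a`. -/
inductive GateKind (Γ : Type) (n : ℕ) : Type
  | and : GateKind Γ n
  | or : GateKind Γ n
  | not : GateKind Γ n
  | input (i : Fin n) (a : Γ) : GateKind Γ n

/-- Circuits reading words of length `n` over `Γ`. `wire g h` means that `h` is an input of `g`.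
Every wire strictly decreases `level`, so that the circuit is acyclic and the length of every path
starting at `g` is at most `level g`. -/
structure Circuit (Γ : Type) (n : ℕ) where
  Gate : Type
  fintypeGate : Fintype Gate
  kind : Gate → GateKind Γ n
  wire : Gate → Gate → Prop
  output : Gate
  level : Gate → ℕ
  level_lt : ∀ g h, wire g h → level h < level g
  not_fanin : ∀ g, kind g = .not → ∃! h, wire g h

/-- The number of gates. -/
def Circuit.size {Γ : Type} {n : ℕ} (C : Circuit Γ n) : ℕ :=
  @Fintype.card C.Gate C.fintypeGate

/-- The circuit has depth at most `d`. -/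
def Circuit.DepthLE {Γ : Type} {n : ℕ} (C : Circuit Γ n) (d : ℕ) : Prop :=
  ∀ g, C.level g ≤ d

/-- The value of a gate on an input word. -/
def Circuit.value {Γ : Type} {n : ℕ} (C : Circuit Γ n) (w : Fin n → Γ) (g : C.Gate) : Prop :=
  match C.kind g with
  | .and => ∀ h, ∀ _ : C.wire g h, C.value w h
  | .or => ∃ h, ∃ _ : C.wire g h, C.value w h
  | .not => ∀ h, ∀ _ : C.wire g h, ¬ C.value w h
  | .input i a => w i = a
termination_by C.level g
decreasing_by all_goals exact C.level_lt _ _ (by assumption)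

/-- The circuit accepts a word if its output gate is true. -/
def Circuit.Accepts {Γ : Type} {n : ℕ} (C : Circuit Γ n) (w : Fin n → Γ) : Prop :=
  C.value w C.output

/-- Relation symbols of arithmetic: the order and the graphs of addition and multiplication. -/
inductive ArithRel : ℕ → Type
  | le : ArithRel 2
  | add : ArithRel 3
  | mul : ArithRel 3

/-- The first-order language of `≤`, `+`, `×` (as relations). -/
def arithLanguage : FirstOrder.Language := ⟨fun _ => Empty, ArithRel⟩

/-- The initial segment `{0, …, m - 1}` with its order, addition and multiplication. -/
instance arithStructure (m : ℕ) : arithLanguage.Structure (Fin m) where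
  funMap f _ := f.elim
  RelMap {_} R := match R with
    | .le => fun v => (v 0 : ℕ) ≤ v 1
    | .add => fun v => (v 0 : ℕ) + v 1 = v 2
    | .mul => fun v => (v 0 : ℕ) * v 1 = v 2

/-- A sequence of relations, the `n`-th one on `{0, …, n}`, is defined by one first-order formula
over `≤`, `+`, `×`. -/
def FODefinable {ι : Type} (P : ∀ n : ℕ, (ι → Fin (n + 1)) → Prop) : Prop :=
  ∃ φ : arithLanguage.Formula ι, ∀ (n : ℕ) (v : ι → Fin (n + 1)), φ.Realize v ↔ P n v

/-- First-order uniformity of a family of circuits: the gates of the `n`-th circuit can be named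
by a tag from a fixed finite set and a tuple of fixed length over `{0, …, n}` in such a way that
the set of gates, their kinds, the wires and the output gate are first-order definable over
`≤`, `+`, `×`. -/
def FOUniform {Γ : Type} (C : ∀ n, Circuit Γ n) : Prop :=
  ∃ (t k : ℕ) (name : ∀ n, (C n).Gate ↪ Fin t × (Fin k → Fin (n + 1))),
    (∀ i, FODefinable fun n (x : Fin k → Fin (n + 1)) => ∃ g, name n g = (i, x)) ∧
    (∀ i, FODefinable fun n (x : Fin k → Fin (n + 1)) =>
      ∃ g, name n g = (i, x) ∧ (C n).kind g = .and) ∧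
    (∀ i, FODefinable fun n (x : Fin k → Fin (n + 1)) =>
      ∃ g, name n g = (i, x) ∧ (C n).kind g = .or) ∧
    (∀ i, FODefinable fun n (x : Fin k → Fin (n + 1)) =>
      ∃ g, name n g = (i, x) ∧ (C n).kind g = .not) ∧
    (∀ i a, FODefinable fun n (x : Fin k ⊕ Unit → Fin (n + 1)) =>
      ∃ (g : (C n).Gate) (j : Fin n), name n g = (i, fun l => x (Sum.inl l)) ∧
        (x (Sum.inr ()) : ℕ) = j ∧ (C n).kind g = .input j a) ∧
    (∀ i i', FODefinable fun n (x : Fin k ⊕ Fin k → Fin (n + 1)) =>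
      ∃ g h, name n g = (i, fun l => x (Sum.inl l)) ∧ name n h = (i', fun l => x (Sum.inr l)) ∧
        (C n).wire g h) ∧
    (∀ i, FODefinable fun n (x : Fin k → Fin (n + 1)) => name n (C n).output = (i, x))

/-- Uniform `AC⁰`: languages decided by a first-order uniform family of circuits of polynomial
size and bounded depth with unbounded fan-in. -/
def InAC0 {Γ : Type} [Finite Γ] (L : Language Γ) : Prop :=
  ∃ C : ∀ n, Circuit Γ n,
    (∃ P : Polynomial ℕ, ∀ n, (C n).size ≤ P.eval n) ∧
    (∃ d : ℕ, ∀ n, (C n).DepthLE d) ∧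
    FOUniform C ∧
    ∀ w : List Γ, w ∈ L ↔ (C w.length).Accepts w.get

/-! ## The decision problem -/

/-- The alphabet in which databases are written: the two bits, an end marker for constants
(`none`), and the relation symbols. -/
abbrev DBSymbol (σ : Schema) : Type := Option Bool ⊕ σ.Rel

instance finiteDBSymbol (σ : Schema) : Finite (DBSymbol σ) := by
  have := σ.finite_rel
  infer_instance

/-- A constant is written as the sequence of its bits, followed by the end marker. -/
def encodeConst (σ : Schema) (c : Const) : List (DBSymbol σ) :=
  c.map (fun b => Sum.inl (some b)) ++ [Sum.inl none]

/-- A fact is written as its relation symbol followed by its arguments. -/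
def encodeFact {σ : Schema} (f : DBFact σ) : List (DBSymbol σ) :=
  Sum.inr f.rel :: (List.ofFn f.args).flatMap (encodeConst σ)

/-- The word `w` represents the instance `(D, α)`: it is `α` followed by a list of the facts of
`D`, in any order and possibly with repetitions. -/
def Represents {σ : Schema} (w : List (DBSymbol σ)) (D : Database σ) (α : DBFact σ) : Prop :=
  ∃ l : List (DBFact σ), (∀ f, f ∈ l ↔ f ∈ D) ∧ w = encodeFact α ++ l.flatMap encodeFact

/-- The positive-relevance problem for the fixed query `q`: the representations of the pairs
`(D, α)` such that `α ∈ D` is positive-relevant for `q` in `D`. -/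
def relevanceLanguage {σ : Schema} (q : UCQNeg σ) : Language (DBSymbol σ) :=
  {w | ∃ (D : Database σ) (α : DBFact σ), Represents w D α ∧ α ∈ D ∧ PositiveRelevant q D α}

/-! ## Uniform first-order definability -/

/-! Negated atoms are tested against the fixed set of absent facts over the active domain, so a
subset of `D` is a positive support as soon as it contains the image of the positive atoms of some
disjunct under a valuation that is good for `D` (`isPositiveSupport_iff`). The minimal supports are
therefore the inclusion-minimal images of this kind, and a fact is relevant when it lies in one
(`positiveRelevant_iff`). Each image has bounded size. By safety only the variables of positive
atoms matter, and their values lie in the active domain. So relevance is expressed by quantifying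
existentially over one bounded tuple of constants and universally over a second
(`positiveRelevant_iff_valuation`).

The formula is built once, in `uniformlyDefinable_positiveRelevant`, for any family of structures
whose elements name constants through a map `dec` covering the active domain, provided equality of
names, membership of a named fact in the database and being a given query constant are definable.
With the evaluation domain itself as names this gives the formulas over databases. With the
positions of a word as names, each naming the constant that starts there, it gives a sentence about
encodings. Whether a word is an encoding is first-order too, because relation symbols and end
markers make the code parsable by local conditions (`isInstanceWord_iff`).

A first-order sentence about words with arithmetic is evaluated by a circuit whose gates are pairs
of a subformula and an assignment of its registers. The depth is the height of the formula, the size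
is polynomial, and the tuples of registers name the gates uniformly (`inAC0_of_uniformlyDefinable`).
-/

/-- A family of relations, the one with index `x` on the structure `M x`, is defined by one
first-order formula. -/
def UniformlyDefinable (L : FirstOrder.Language.{0, 0}) {X : Type} (M : X → Type)
    [∀ x, L.Structure (M x)]
    {ι : Type} (P : ∀ x, (ι → M x) → Prop) : Prop :=
  ∃ φ : L.Formula ι, ∀ x v, φ.Realize v ↔ P x v

namespace UniformlyDefinable

variable {L : FirstOrder.Language.{0, 0}} {X : Type} {M : X → Type}
  [∀ x, L.Structure (M x)] {ι κ : Type}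
  {P Q : ∀ x, (ι → M x) → Prop}

theorem congr (hP : UniformlyDefinable L M P) (h : ∀ x v, Q x v ↔ P x v) :
    UniformlyDefinable L M Q := by
  obtain ⟨φ, hφ⟩ := hP
  exact ⟨φ, fun x v => (hφ x v).trans (h x v).symm⟩

theorem reindex (hP : UniformlyDefinable L M P) (f : ι → κ) :
    UniformlyDefinable L M fun x (v : κ → M x) => P x fun i => v (f i) := by
  obtain ⟨φ, hφ⟩ := hP
  exact ⟨φ.relabel f, fun x v => by rw [FirstOrder.Language.Formula.realize_relabel, hφ]; rfl⟩

/-- Carries definability over all words to the words that encode instances. -/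
theorem pullback {Y : Type} (hP : UniformlyDefinable L M P) (f : Y → X) :
    UniformlyDefinable L (fun y => M (f y)) fun y v => P (f y) v := by
  obtain ⟨φ, hφ⟩ := hP
  exact ⟨φ, fun y v => hφ (f y) v⟩

theorem const (p : Prop) : UniformlyDefinable L M fun x (_ : ι → M x) => p := by
  by_cases h : p
  · exact ⟨⊤, fun x v => by simp [h]⟩
  · exact ⟨⊥, fun x v => by simp [h]⟩

theorem not (hP : UniformlyDefinable L M P) : UniformlyDefinable L M fun x v => ¬ P x v := by
  obtain ⟨φ, hφ⟩ := hP
  exact ⟨φ.not, fun x v => by rw [FirstOrder.Language.Formula.realize_not, hφ]⟩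

theorem and (hP : UniformlyDefinable L M P) (hQ : UniformlyDefinable L M Q) :
    UniformlyDefinable L M fun x v => P x v ∧ Q x v := by
  obtain ⟨φ, hφ⟩ := hP
  obtain ⟨ψ, hψ⟩ := hQ
  exact ⟨φ ⊓ ψ, fun x v => by rw [FirstOrder.Language.Formula.realize_inf, hφ, hψ]⟩

theorem or (hP : UniformlyDefinable L M P) (hQ : UniformlyDefinable L M Q) :
    UniformlyDefinable L M fun x v => P x v ∨ Q x v :=
  (hP.not.and hQ.not).not.congr fun x v => by tauto

theorem imp (hP : UniformlyDefinable L M P) (hQ : UniformlyDefinable L M Q) :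
    UniformlyDefinable L M fun x v => P x v → Q x v :=
  (hP.and hQ.not).not.congr fun x v => by tauto

theorem iff (hP : UniformlyDefinable L M P) (hQ : UniformlyDefinable L M Q) :
    UniformlyDefinable L M fun x v => (P x v ↔ Q x v) :=
  ((hP.imp hQ).and (hQ.imp hP)).congr fun x v => by tauto

theorem eq (i j : ι) : UniformlyDefinable L M fun _ v => v i = v j :=
  ⟨(FirstOrder.Language.Term.var i).equal (FirstOrder.Language.Term.var j), fun x v => by
    simp [FirstOrder.Language.Formula.realize_equal]⟩

theorem exTuple [Finite κ] {P : ∀ x, (ι → M x) → (κ → M x) → Prop}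
    (hP : UniformlyDefinable L M fun x (v : ι ⊕ κ → M x) =>
      P x (fun i => v (Sum.inl i)) fun i => v (Sum.inr i)) :
    UniformlyDefinable L M fun x v => ∃ u, P x v u := by
  obtain ⟨φ, hφ⟩ := hP
  exact ⟨φ.iExs κ, fun x v => by
    rw [FirstOrder.Language.Formula.realize_iExs]
    exact exists_congr fun u => hφ x _⟩

theorem allTuple [Finite κ] {P : ∀ x, (ι → M x) → (κ → M x) → Prop}
    (hP : UniformlyDefinable L M fun x (v : ι ⊕ κ → M x) =>
      P x (fun i => v (Sum.inl i)) fun i => v (Sum.inr i)) :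
    UniformlyDefinable L M fun x v => ∀ u, P x v u :=
  (exTuple (P := fun x v u => ¬ P x v u) hP.not).not.congr fun x v => by simp

theorem ex {P : ∀ x, (ι → M x) → M x → Prop}
    (hP : UniformlyDefinable L M fun x (v : ι ⊕ Unit → M x) =>
      P x (fun i => v (Sum.inl i)) (v (Sum.inr ()))) :
    UniformlyDefinable L M fun x v => ∃ a, P x v a :=
  (exTuple (P := fun x v u => P x v (u ())) hP).congr fun _ _ =>
    ⟨fun ⟨a, h⟩ => ⟨fun _ => a, h⟩, fun ⟨u, h⟩ => ⟨u (), h⟩⟩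

theorem all {P : ∀ x, (ι → M x) → M x → Prop}
    (hP : UniformlyDefinable L M fun x (v : ι ⊕ Unit → M x) =>
      P x (fun i => v (Sum.inl i)) (v (Sum.inr ()))) :
    UniformlyDefinable L M fun x v => ∀ a, P x v a :=
  (ex (P := fun x v u => ¬ P x v u) hP.not).not.congr fun x v => by simp

theorem existsMem {α : Type} (l : List α) {P : α → ∀ x, (ι → M x) → Prop}
    (hP : ∀ a ∈ l, UniformlyDefinable L M (P a)) :
    UniformlyDefinable L M fun x v => ∃ a ∈ l, P a x v := by
  induction l with
  | nil => exact (const False).congr fun x v => by simp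
  | cons b l ih =>
    exact ((hP b (by simp)).or (ih fun a ha => hP a (by simp [ha]))).congr fun x v => by simp

theorem forallMem {α : Type} (l : List α) {P : α → ∀ x, (ι → M x) → Prop}
    (hP : ∀ a ∈ l, UniformlyDefinable L M (P a)) :
    UniformlyDefinable L M fun x v => ∀ a ∈ l, P a x v :=
  (existsMem l fun a ha => (hP a ha).not).not.congr fun x v => by simp

theorem existsFinite {α : Type} [Finite α] {P : α → ∀ x, (ι → M x) → Prop}
    (hP : ∀ a, UniformlyDefinable L M (P a)) :
    UniformlyDefinable L M fun x v => ∃ a, P a x v := by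
  have := Fintype.ofFinite α
  exact (existsMem Finset.univ.toList fun a _ => hP a).congr fun x v => by simp

theorem forallFinite {α : Type} [Finite α] {P : α → ∀ x, (ι → M x) → Prop}
    (hP : ∀ a, UniformlyDefinable L M (P a)) :
    UniformlyDefinable L M fun x v => ∀ a, P a x v :=
  (existsFinite fun a => (hP a).not).not.congr fun x v => by simp

end UniformlyDefinable

/-! ## Evaluation of circuits -/

namespace Circuit

variable {Γ : Type} {n : ℕ} (C : Circuit Γ n) (w : Fin n → Γ) {g : C.Gate}

theorem value_of_and (hg : C.kind g = .and) : C.value w g ↔ ∀ h, C.wire g h → C.value w h := by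
  rw [Circuit.value, hg]

theorem value_of_or (hg : C.kind g = .or) : C.value w g ↔ ∃ h, C.wire g h ∧ C.value w h := by
  rw [Circuit.value, hg]
  simp

theorem value_of_not (hg : C.kind g = .not) : C.value w g ↔ ∀ h, C.wire g h → ¬ C.value w h := by
  rw [Circuit.value, hg]

theorem value_of_input {i : Fin n} {a : Γ} (hg : C.kind g = .input i a) :
    C.value w g ↔ w i = a := by
  rw [Circuit.value, hg]

end Circuit

/-! ## First-order queries on words are decided by uniform circuits -/

/-- First-order queries on words over `Γ`, with the `k` registers ranging over `{0, …, n}` where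
`n` is the length of the word. -/
inductive WordQuery (Γ : Type) (k : ℕ) : Type
  | arith (φ : arithLanguage.Formula (Fin k)) : WordQuery Γ k
  | letter (a : Γ) (i : Fin k) : WordQuery Γ k
  | not (φ : WordQuery Γ k) : WordQuery Γ k
  | and (φ ψ : WordQuery Γ k) : WordQuery Γ k
  | all (i : Fin k) (φ : WordQuery Γ k) : WordQuery Γ k

namespace WordQuery

variable {Γ : Type} {k : ℕ}

/-- The truth of a query on a word. -/
def Realize {n : ℕ} (w : Fin n → Γ) : WordQuery Γ k → (Fin k → Fin (n + 1)) → Prop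
  | arith φ, x => φ.Realize x
  | letter a i, x => ∃ h : (x i : ℕ) < n, w ⟨x i, h⟩ = a
  | not φ, x => ¬ φ.Realize w x
  | and φ ψ, x => φ.Realize w x ∧ ψ.Realize w x
  | all i φ, x => ∀ b, φ.Realize w (Function.update x i b)

/-- The height of the syntax tree. -/
def height : WordQuery Γ k → ℕ
  | arith _ => 0
  | letter _ _ => 0
  | not φ => φ.height + 1
  | and φ ψ => max φ.height ψ.height + 1
  | all _ φ => φ.height + 1

/-- The subqueries. -/
def subqueries : WordQuery Γ k → Set (WordQuery Γ k)
  | arith φ => {arith φ}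
  | letter a i => {letter a i}
  | not φ => insert (not φ) φ.subqueries
  | and φ ψ => insert (and φ ψ) (φ.subqueries ∪ ψ.subqueries)
  | all i φ => insert (all i φ) φ.subqueries

theorem self_mem_subqueries (φ : WordQuery Γ k) : φ ∈ φ.subqueries := by
  cases φ <;> simp [subqueries]

theorem finite_subqueries (φ : WordQuery Γ k) : φ.subqueries.Finite := by
  induction φ with
  | arith φ => exact Set.finite_singleton _
  | letter a i => exact Set.finite_singleton _
  | not φ ih => exact ih.insert _
  | and φ ψ ih ih' => exact (ih.union ih').insert _
  | all i φ ih => exact ih.insert _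

theorem height_le_of_mem_subqueries {φ ψ : WordQuery Γ k} (h : ψ ∈ φ.subqueries) :
    ψ.height ≤ φ.height := by
  induction φ with
  | arith φ => rw [Set.mem_singleton_iff.1 h]
  | letter a i => rw [Set.mem_singleton_iff.1 h]
  | not φ ih =>
    rcases h with rfl | h
    · exact le_rfl
    · exact (ih h).trans (Nat.le_succ _)
  | and φ φ' ih ih' =>
    rcases h with rfl | h | h
    · exact le_rfl
    · exact (ih h).trans ((le_max_left _ _).trans (Nat.le_succ _))
    · exact (ih' h).trans ((le_max_right _ _).trans (Nat.le_succ _))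
  | all i φ ih =>
    rcases h with rfl | h
    · exact le_rfl
    · exact (ih h).trans (Nat.le_succ _)

/-- The instance `(ψ, y)` occurs as an immediate constituent of the instance `(φ, x)`. -/
def Child {n : ℕ} : WordQuery Γ k → WordQuery Γ k → (Fin k → Fin (n + 1)) →
    (Fin k → Fin (n + 1)) → Prop
  | arith _, _, _, _ => False
  | letter _ _, _, _, _ => False
  | not φ, ψ, x, y => ψ = φ ∧ ∀ l, y l = x l
  | and φ φ', ψ, x, y => (ψ = φ ∨ ψ = φ') ∧ ∀ l, y l = x l
  -- Register `i` of the child is free: one child for each value of the quantified variable.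
  | all i φ, ψ, x, y => ψ = φ ∧ ∀ l, l ≠ i → y l = x l

theorem Child.height_lt {n : ℕ} {φ ψ : WordQuery Γ k} {x y : Fin k → Fin (n + 1)}
    (h : Child φ ψ x y) : ψ.height < φ.height := by
  cases φ with
  | arith φ => exact h.elim
  | letter a i => exact h.elim
  | not φ => rw [h.1]; exact Nat.lt_succ_self _
  | and φ φ' =>
    rcases h.1 with rfl | rfl
    · exact Nat.lt_succ_of_le (le_max_left _ _)
    · exact Nat.lt_succ_of_le (le_max_right _ _)
  | all i φ => rw [h.1]; exact Nat.lt_succ_self _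

/-- Transitivity of the subquery relation, so that the constituents of a gate of the circuit for `χ`
are again gates of it. -/
theorem Child.mem_subqueries {n : ℕ} {χ φ ψ : WordQuery Γ k} {x y : Fin k → Fin (n + 1)}
    (h : Child φ ψ x y) (hφ : φ ∈ χ.subqueries) : ψ ∈ χ.subqueries := by
  have key : ψ ∈ φ.subqueries := by
    cases φ with
    | arith φ => exact h.elim
    | letter a i => exact h.elim
    | not φ => rw [h.1]; exact Or.inr (self_mem_subqueries _)
    | and φ φ' =>
      rcases h.1 with rfl | rfl
      · exact Or.inr (Or.inl (self_mem_subqueries _))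
      · exact Or.inr (Or.inr (self_mem_subqueries _))
    | all i φ => rw [h.1]; exact Or.inr (self_mem_subqueries _)
  clear h
  induction χ with
  | arith χ => rw [Set.mem_singleton_iff.1 hφ] at key; exact key
  | letter a i => rw [Set.mem_singleton_iff.1 hφ] at key; exact key
  | not χ ih =>
    rcases hφ with rfl | h
    · exact key
    · exact Or.inr (ih h)
  | and χ χ' ih ih' =>
    rcases hφ with rfl | h | h
    · exact key
    · exact Or.inr (Or.inl (ih h))
    · exact Or.inr (Or.inr (ih' h))
  | all i χ ih =>
    rcases hφ with rfl | h
    · exact key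
    · exact Or.inr (ih h)

open Classical in
/-- The kind of the gate that evaluates an instance of a query. -/
noncomputable def gateKind (n : ℕ) : WordQuery Γ k → (Fin k → Fin (n + 1)) → GateKind Γ n
  -- Leaves have no wires, so AND serves as the constant true and OR as the constant false. A
  -- register pointing at the end position `n` reads no letter and also gives false.
  | arith φ, x => if φ.Realize x then .and else .or
  | letter a i, x => if h : (x i : ℕ) < n then .input ⟨x i, h⟩ a else .or
  | not _, _ => .not
  | and _ _, _ => .and
  | all _ _, _ => .and

open Classical in
/-- The circuit that evaluates a query on the words of length `n`: its gates are the instances of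
the subqueries. -/
noncomputable def circuit (χ : WordQuery Γ k) (n : ℕ) : Circuit Γ n where
  Gate := χ.subqueries × (Fin k → Fin (n + 1))
  fintypeGate := by
    have := χ.finite_subqueries.fintype
    infer_instance
  kind g := gateKind n g.1 g.2
  wire g h := Child g.1.1 h.1.1 g.2 h.2
  output := (⟨χ, χ.self_mem_subqueries⟩, fun _ => 0)
  level g := g.1.1.height
  level_lt _ _ h := h.height_lt
  not_fanin := by
    rintro ⟨⟨φ, hφ⟩, x⟩ hg
    cases φ with
    | arith φ => simp only [gateKind] at hg; split_ifs at hg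
    | letter a i => simp only [gateKind] at hg; split_ifs at hg
    | not φ =>
      have hc : Child (not φ) φ x x := ⟨rfl, fun _ => rfl⟩
      refine ⟨(⟨φ, hc.mem_subqueries hφ⟩, x), hc, ?_⟩
      rintro ⟨⟨ψ, hψ⟩, y⟩ ⟨h, h'⟩
      exact Prod.ext (Subtype.ext h) (funext h')
    | and φ φ' => simp [gateKind] at hg
    | all i φ => simp [gateKind] at hg

theorem kind_circuit (χ : WordQuery Γ k) {n : ℕ} (φ : WordQuery Γ k) (hφ : φ ∈ χ.subqueries)
    (x : Fin k → Fin (n + 1)) : (χ.circuit n).kind (⟨φ, hφ⟩, x) = gateKind n φ x :=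
  rfl

theorem value_circuit (χ : WordQuery Γ k) {n : ℕ} (w : Fin n → Γ) (φ : WordQuery Γ k)
    (hφ : φ ∈ χ.subqueries) (x : Fin k → Fin (n + 1)) :
    (χ.circuit n).value w (⟨φ, hφ⟩, x) ↔ φ.Realize w x := by
  induction φ generalizing x with
  | arith φ =>
    by_cases h : φ.Realize x
    · refine ((χ.circuit n).value_of_and w (g := (⟨_, hφ⟩, x))
        ((χ.kind_circuit _ hφ x).trans (by simp [gateKind, h]))).trans ?_
      exact iff_of_true (fun _ h' => h'.elim) h
    · refine ((χ.circuit n).value_of_or w (g := (⟨_, hφ⟩, x))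
        ((χ.kind_circuit _ hφ x).trans (by simp [gateKind, h]))).trans ?_
      exact iff_of_false (fun ⟨_, h', _⟩ => h'.elim) h
  | letter a i =>
    by_cases h : (x i : ℕ) < n
    · refine ((χ.circuit n).value_of_input w (i := ⟨x i, h⟩) (a := a) (g := (⟨_, hφ⟩, x))
        ((χ.kind_circuit _ hφ x).trans (by simp [gateKind, h]))).trans ?_
      exact ⟨fun h' => ⟨h, h'⟩, fun ⟨_, h'⟩ => h'⟩
    · refine ((χ.circuit n).value_of_or w (g := (⟨_, hφ⟩, x))
        ((χ.kind_circuit _ hφ x).trans (by simp [gateKind, h]))).trans ?_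
      exact iff_of_false (fun ⟨_, h', _⟩ => h'.elim) fun ⟨h', _⟩ => h h'
  | not φ ih =>
    have hc : Child (not φ) φ x x := ⟨rfl, fun _ => rfl⟩
    refine ((χ.circuit n).value_of_not w (g := (⟨_, hφ⟩, x))
        ((χ.kind_circuit _ hφ x).trans (by simp [gateKind]))).trans ?_
    constructor
    · intro H h
      exact H (⟨φ, hc.mem_subqueries hφ⟩, x) hc ((ih _ _).2 h)
    · rintro H ⟨⟨ψ, hψ⟩, y⟩ ⟨h, h'⟩ hv
      obtain rfl : ψ = φ := h
      obtain rfl : y = x := funext h'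
      exact H ((ih _ _).1 hv)
  | and φ φ' ih ih' =>
    have hc : Child (and φ φ') φ x x := ⟨Or.inl rfl, fun _ => rfl⟩
    have hc' : Child (and φ φ') φ' x x := ⟨Or.inr rfl, fun _ => rfl⟩
    refine ((χ.circuit n).value_of_and w (g := (⟨_, hφ⟩, x))
        ((χ.kind_circuit _ hφ x).trans (by simp [gateKind]))).trans ?_
    constructor
    · intro H
      exact ⟨(ih _ _).1 (H (⟨φ, hc.mem_subqueries hφ⟩, x) hc),
        (ih' _ _).1 (H (⟨φ', hc'.mem_subqueries hφ⟩, x) hc')⟩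
    · rintro H ⟨⟨ψ, hψ⟩, y⟩ ⟨h, h'⟩
      obtain rfl : y = x := funext h'
      have h : ψ = φ ∨ ψ = φ' := h
      rcases h with rfl | rfl
      · exact (ih _ _).2 H.1
      · exact (ih' _ _).2 H.2
  | all i φ ih =>
    have hc (b) : Child (all i φ) φ x (Function.update x i b) :=
      ⟨rfl, fun l hl => Function.update_of_ne hl _ _⟩
    refine ((χ.circuit n).value_of_and w (g := (⟨_, hφ⟩, x))
        ((χ.kind_circuit _ hφ x).trans (by simp [gateKind]))).trans ?_
    constructor
    · intro H b
      exact (ih _ _).1 (H (⟨φ, (hc b).mem_subqueries hφ⟩, _) (hc b))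
    · rintro H ⟨⟨ψ, hψ⟩, y⟩ ⟨h, h'⟩
      obtain rfl : ψ = φ := h
      refine (ih _ _).2 ?_
      have hy : y = Function.update x i (y i) := by
        ext l
        by_cases hl : l = i
        · subst hl; simp
        · rw [Function.update_of_ne hl]; exact congrArg Fin.val (h' l hl)
      rw [hy]
      exact H _

/-! ### Uniformity of the circuits -/

theorem uniformlyDefinable_arith_le {ι : Type} (i j : ι) :
    UniformlyDefinable arithLanguage (fun n : ℕ => Fin (n + 1)) fun _ v => v i ≤ v j :=
  ⟨FirstOrder.Language.Relations.formula₂ (L := arithLanguage)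
      (show arithLanguage.Relations 2 from ArithRel.le) (.var i) (.var j),
    fun _ _ => FirstOrder.Language.Formula.realize_rel₂⟩

theorem uniformlyDefinable_arith_lt_top {ι : Type} (i : ι) :
    UniformlyDefinable arithLanguage (fun n : ℕ => Fin (n + 1)) fun n v => (v i : ℕ) < n := by
  refine (UniformlyDefinable.ex (P := fun _ v a => ¬ a ≤ v i)
    (uniformlyDefinable_arith_le _ _).not).congr fun n v => ?_
  constructor
  · intro h
    exact ⟨Fin.last n, by rw [not_le]; exact h⟩
  · rintro ⟨a, ha⟩
    have := a.2
    simp only [Fin.le_def] at ha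
    omega

theorem uniformlyDefinable_arith_eq_zero {ι : Type} (i : ι) :
    UniformlyDefinable arithLanguage (fun n : ℕ => Fin (n + 1)) fun _ v => v i = 0 := by
  refine (UniformlyDefinable.all (P := fun _ v a => v i ≤ a)
    (uniformlyDefinable_arith_le _ _)).congr fun n v => ?_
  exact ⟨fun h a => h ▸ Fin.zero_le a, fun h => Fin.le_zero_iff.1 (h 0)⟩

open UniformlyDefinable in
theorem uniformlyDefinable_child (φ ψ : WordQuery Γ k) :
    UniformlyDefinable arithLanguage (fun n : ℕ => Fin (n + 1))
      fun n (x : Fin k ⊕ Fin k → Fin (n + 1)) =>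
        Child φ ψ (fun l => x (Sum.inl l)) fun l => x (Sum.inr l) := by
  cases φ with
  | arith φ => exact const False
  | letter a i => exact const False
  | not φ => exact (const (ψ = φ)).and (forallFinite fun l => eq _ _)
  | and φ φ' => exact (const (ψ = φ ∨ ψ = φ')).and (forallFinite fun l => eq _ _)
  | all i φ =>
    exact (const (ψ = φ)).and (forallFinite fun l => (const (l ≠ i)).imp (eq _ _))

open UniformlyDefinable in
-- An arithmetic leaf is an AND gate exactly when its formula holds, so the formula itself is the
-- uniformity condition. This is why whole arithmetic formulas can be leaves.
theorem uniformlyDefinable_gateKind_and (φ : WordQuery Γ k) :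
    UniformlyDefinable arithLanguage (fun n : ℕ => Fin (n + 1))
      fun n (x : Fin k → Fin (n + 1)) => gateKind n φ x = .and := by
  cases φ with
  | arith φ => exact ⟨φ, fun n x => by simp [gateKind]⟩
  | letter a i =>
    exact (const False).congr fun n x => by by_cases h : (x i : ℕ) < n <;> simp [gateKind, h]
  | not φ => exact (const False).congr fun n x => by simp [gateKind]
  | and φ φ' => exact (const True).congr fun n x => by simp [gateKind]
  | all i φ => exact (const True).congr fun n x => by simp [gateKind]

open UniformlyDefinable in
theorem uniformlyDefinable_gateKind_or (φ : WordQuery Γ k) :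
    UniformlyDefinable arithLanguage (fun n : ℕ => Fin (n + 1))
      fun n (x : Fin k → Fin (n + 1)) => gateKind n φ x = .or := by
  cases φ with
  | arith φ => exact ⟨φ.not, fun n x => by simp [gateKind]⟩
  | letter a i =>
    exact (uniformlyDefinable_arith_lt_top i).not.congr fun n x => by
      by_cases h : (x i : ℕ) < n <;> simp [gateKind, h]
  | not φ => exact (const False).congr fun n x => by simp [gateKind]
  | and φ φ' => exact (const False).congr fun n x => by simp [gateKind]
  | all i φ => exact (const False).congr fun n x => by simp [gateKind]

open UniformlyDefinable in
theorem uniformlyDefinable_gateKind_not (φ : WordQuery Γ k) :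
    UniformlyDefinable arithLanguage (fun n : ℕ => Fin (n + 1))
      fun n (x : Fin k → Fin (n + 1)) => gateKind n φ x = .not := by
  cases φ with
  | arith φ =>
    exact (const False).congr fun n x => by by_cases h : φ.Realize x <;> simp [gateKind, h]
  | letter a i =>
    exact (const False).congr fun n x => by by_cases h : (x i : ℕ) < n <;> simp [gateKind, h]
  | not φ => exact (const True).congr fun n x => by simp [gateKind]
  | and φ φ' => exact (const False).congr fun n x => by simp [gateKind]
  | all i φ => exact (const False).congr fun n x => by simp [gateKind]

open UniformlyDefinable in
theorem uniformlyDefinable_gateKind_input (φ : WordQuery Γ k) (a : Γ) :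
    UniformlyDefinable arithLanguage (fun n : ℕ => Fin (n + 1))
      fun n (x : Fin k ⊕ Unit → Fin (n + 1)) => ∃ j : Fin n, (x (Sum.inr ()) : ℕ) = j ∧
        gateKind n φ (fun l => x (Sum.inl l)) = .input j a := by
  cases φ with
  | arith φ =>
    exact (const False).congr fun n x => by
      by_cases h : φ.Realize (fun l => x (Sum.inl l)) <;> simp [gateKind, h]
  | letter b i =>
    refine (((const (b = a)).and (eq (Sum.inr ()) (Sum.inl i))).and
      (uniformlyDefinable_arith_lt_top (Sum.inl i))).congr fun n x => ?_
    by_cases h : (x (Sum.inl i) : ℕ) < n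
    · simp only [gateKind, h, dif_pos, GateKind.input.injEq, Fin.ext_iff, and_true]
      constructor
      · rintro ⟨j, h1, h2, h3⟩
        exact ⟨h3, by omega⟩
      · rintro ⟨h1, h2⟩
        exact ⟨⟨_, h⟩, h2, rfl, h1⟩
    · simp [gateKind, h]
  | not φ => exact (const False).congr fun n x => by simp [gateKind]
  | and φ φ' => exact (const False).congr fun n x => by simp [gateKind]
  | all i φ => exact (const False).congr fun n x => by simp [gateKind]

open UniformlyDefinable in
theorem foUniform_circuit (χ : WordQuery Γ k) : FOUniform χ.circuit := by
  have := χ.finite_subqueries.to_subtype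
  obtain ⟨t, ⟨e⟩⟩ := Finite.exists_equiv_fin χ.subqueries
  -- The naming is a bijection onto all pairs of a tag and a tuple, so a property of the gate named
  -- `(i, x)` needs no existential quantifier.
  have key (n : ℕ) (i : Fin t) (x : Fin k → Fin (n + 1)) (Q : (χ.circuit n).Gate → Prop) :
      (∃ g : (χ.circuit n).Gate, ((e.prodCongr (Equiv.refl _)) g = (i, x)) ∧ Q g) ↔
        Q (e.symm i, x) := by
    constructor
    · rintro ⟨⟨ψ, y⟩, h, hQ⟩
      obtain ⟨rfl, rfl⟩ := Prod.mk.inj h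
      simpa using hQ
    · intro hQ
      exact ⟨(e.symm i, x), by simp, hQ⟩
  refine ⟨t, k, fun n => (e.prodCongr (Equiv.refl _)).toEmbedding, fun i => ?_, fun i => ?_,
    fun i => ?_, fun i => ?_, fun i a => ?_, fun i j => ?_, fun i => ?_⟩
  · exact (const True).congr fun n x => iff_of_true
      (((key n i x fun _ => True).2 trivial).imp fun _ h => h.1) trivial
  · exact (uniformlyDefinable_gateKind_and (e.symm i).1).congr fun n x => key n i x _
  · exact (uniformlyDefinable_gateKind_or (e.symm i).1).congr fun n x => key n i x _
  · exact (uniformlyDefinable_gateKind_not (e.symm i).1).congr fun n x => key n i x _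
  · refine (uniformlyDefinable_gateKind_input (e.symm i).1 a).congr fun n x => ?_
    refine Iff.trans ?_ (key n i (fun l => x (Sum.inl l)) fun g => ∃ j : Fin n,
      (x (Sum.inr ()) : ℕ) = j ∧ (χ.circuit n).kind g = .input j a)
    exact exists_congr fun g => exists_and_left
  · refine (uniformlyDefinable_child (e.symm i).1 (e.symm j).1).congr fun n x => ?_
    refine Iff.trans ?_ ((key n i (fun l => x (Sum.inl l)) fun g => ∃ h : (χ.circuit n).Gate,
      (e.prodCongr (Equiv.refl _)) h = (j, fun l => x (Sum.inr l)) ∧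
        (χ.circuit n).wire g h).trans (key n j (fun l => x (Sum.inr l)) _))
    exact exists_congr fun g => exists_and_left
  · refine ((const (e ⟨χ, χ.self_mem_subqueries⟩ = i)).and
      (forallFinite fun l => uniformlyDefinable_arith_eq_zero l)).congr fun n x => ?_
    change (e _, fun _ => 0) = (i, x) ↔ _
    rw [Prod.mk.injEq]
    exact and_congr_right fun _ => ⟨fun h l => (congrFun h l).symm,
      fun h => funext fun l => (h l).symm⟩

theorem inAC0 [Finite Γ] (χ : WordQuery Γ k) (L : Language Γ)
    (hL : ∀ w : List Γ, w ∈ L ↔ χ.Realize w.get fun _ => 0) : InAC0 L := by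
  refine ⟨χ.circuit, ⟨Polynomial.C (Nat.card χ.subqueries) * (Polynomial.X + 1) ^ k, fun n => ?_⟩,
    ⟨χ.height, fun n g => height_le_of_mem_subqueries g.1.2⟩, χ.foUniform_circuit, fun w => ?_⟩
  · have := χ.finite_subqueries.fintype
    have h : (χ.circuit n).size = Nat.card (χ.subqueries × (Fin k → Fin (n + 1))) := by
      rw [Circuit.size, ← @Nat.card_eq_fintype_card _ (χ.circuit n).fintypeGate]
      rfl
    rw [h, Nat.card_prod]
    simp
  · rw [hL, Circuit.Accepts]
    exact (χ.value_circuit w.get χ χ.self_mem_subqueries _).symm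

end WordQuery

/-! ## First-order sentences about words -/

/-- Relation symbols for words: those of arithmetic, and a unary one for every letter. -/
inductive WordRel (Γ : Type) : ℕ → Type
  | arith {m : ℕ} (R : ArithRel m) : WordRel Γ m
  | letter (a : Γ) : WordRel Γ 1

/-- The first-order language of words with arithmetic. -/
def wordLanguage (Γ : Type) : FirstOrder.Language := ⟨fun _ => Empty, WordRel Γ⟩

/-- The positions of a word, including the position after the last letter. -/
abbrev Position {Γ : Type} (w : List Γ) : Type := Fin (w.length + 1)

/-- A word as a first-order structure on its positions. -/
instance wordStructure {Γ : Type} (w : List Γ) : (wordLanguage Γ).Structure (Position w) where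
  funMap f _ := f.elim
  RelMap {_} R := match R with
    | .arith R => FirstOrder.Language.Structure.RelMap (L := arithLanguage) R
    | .letter a => fun v => w[(v 0 : ℕ)]? = some a

namespace WordQuery

variable {Γ : Type}

theorem exists_eq_var {n : ℕ} (t : (wordLanguage Γ).Term (Empty ⊕ Fin n)) :
    ∃ i, t = .var (Sum.inr i) := by
  cases t with
  | var i =>
    rcases i with i | i
    · exact i.elim
    · exact ⟨i, rfl⟩
  | func f _ => exact Empty.elim f

/-- Every formula with bounded variables is expressed by a query with sufficiently many
registers. -/
theorem exists_realize_iff {m : ℕ} (φ : (wordLanguage Γ).BoundedFormula Empty m) :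
    ∃ k₀, ∀ k, k₀ ≤ k → ∀ hk : m ≤ k, ∃ χ : WordQuery Γ k, ∀ (w : List Γ)
      (x : Fin k → Position w), χ.Realize w.get x ↔
        φ.Realize (M := Position w) Empty.elim fun i => x (Fin.castLE hk i) := by
  -- The bound is on all large `k` so that both sides of an implication can use the same number of
  -- registers. Register `i` holds the bound variable of index `i`, and a quantifier at depth `m`
  -- writes to register `m`.
  induction φ with
  | falsum => exact ⟨0, fun k _ hk => ⟨arith ⊥, fun w x => Iff.rfl⟩⟩
  | @equal m t₁ t₂ =>
    refine ⟨0, fun k _ hk => ?_⟩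
    obtain ⟨i, rfl⟩ := exists_eq_var t₁
    obtain ⟨j, rfl⟩ := exists_eq_var t₂
    exact ⟨arith ((FirstOrder.Language.Term.var (Fin.castLE hk i)).equal
      (.var (Fin.castLE hk j))), fun w x => FirstOrder.Language.Formula.realize_equal⟩
  | @rel m l R ts =>
    refine ⟨0, fun k _ hk => ?_⟩
    choose f hf using fun i => exists_eq_var (ts i)
    obtain rfl : ts = fun i => .var (Sum.inr (f i)) := funext hf
    cases R with
    | arith R =>
      exact ⟨arith (FirstOrder.Language.Relations.formula (L := arithLanguage)
        (show arithLanguage.Relations l from R) fun i => .var (Fin.castLE hk (f i))),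
        fun w x => FirstOrder.Language.Formula.realize_rel⟩
    | letter a =>
      refine ⟨letter a (Fin.castLE hk (f 0)), fun w x => ?_⟩
      exact List.getElem?_eq_some_iff.symm
  | @imp m φ ψ ih ih' =>
    obtain ⟨k₁, h₁⟩ := ih
    obtain ⟨k₂, h₂⟩ := ih'
    refine ⟨max k₁ k₂, fun k hk hm => ?_⟩
    obtain ⟨χ, hχ⟩ := h₁ k (le_of_max_le_left hk) hm
    obtain ⟨χ', hχ'⟩ := h₂ k (le_of_max_le_right hk) hm
    refine ⟨not (and χ (not χ')), fun w x => ?_⟩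
    rw [FirstOrder.Language.BoundedFormula.realize_imp, ← hχ, ← hχ']
    simp only [Realize]
    tauto
  | @all m φ ih =>
    obtain ⟨k₁, h₁⟩ := ih
    refine ⟨max k₁ (m + 1), fun k hk hm => ?_⟩
    have hm' : m + 1 ≤ k := le_of_max_le_right hk
    obtain ⟨χ, hχ⟩ := h₁ k (le_of_max_le_left hk) hm'
    refine ⟨all ⟨m, hm'⟩ χ, fun w x => ?_⟩
    rw [FirstOrder.Language.BoundedFormula.realize_all]
    refine forall_congr' fun b => ?_
    rw [hχ]
    refine iff_of_eq (congrArg _ (funext fun i => ?_))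
    refine Fin.lastCases ?_ (fun i => ?_) i
    · rw [Fin.snoc_last]
      exact Function.update_self _ _ _
    · rw [Fin.snoc_castSucc]
      refine Function.update_of_ne (fun h => ?_) _ _
      have := congrArg Fin.val h
      simp at this
      omega

end WordQuery

/-- Languages of words that are first-order definable with arithmetic are in uniform `AC⁰`. -/
theorem inAC0_of_uniformlyDefinable {Γ : Type} [Finite Γ] {L : Language Γ}
    (hL : UniformlyDefinable (wordLanguage Γ) (fun w : List Γ => Position w)
      fun w (_ : Empty → Position w) => w ∈ L) : InAC0 L := by
  obtain ⟨φ, hφ⟩ := hL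
  obtain ⟨k, hk⟩ := WordQuery.exists_realize_iff φ
  obtain ⟨χ, hχ⟩ := hk k le_rfl (Nat.zero_le k)
  refine χ.inAC0 L fun w => ?_
  rw [hχ]
  refine (hφ w Empty.elim).symm.trans ?_
  exact iff_of_eq (congrArg (FirstOrder.Language.BoundedFormula.Realize φ Empty.elim)
    (Subsingleton.elim _ _))

/-! ### Basic definable relations on positions -/

section Atoms

variable {Γ ι : Type}

theorem uniformlyDefinable_position_le (i j : ι) :
    UniformlyDefinable (wordLanguage Γ) (fun w : List Γ => Position w) fun _ v => v i ≤ v j :=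
  ⟨FirstOrder.Language.Relations.formula₂ (L := wordLanguage Γ)
      (show (wordLanguage Γ).Relations 2 from .arith .le) (.var i) (.var j),
    fun _ _ => FirstOrder.Language.Formula.realize_rel₂⟩

theorem uniformlyDefinable_position_add (i j l : ι) :
    UniformlyDefinable (wordLanguage Γ) (fun w : List Γ => Position w)
      fun _ v => (v i : ℕ) + v j = v l :=
  ⟨FirstOrder.Language.Relations.formula (L := wordLanguage Γ) (n := 3)
      (show (wordLanguage Γ).Relations 3 from .arith .add) ![.var i, .var j, .var l],
    fun _ _ => FirstOrder.Language.Formula.realize_rel⟩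

theorem uniformlyDefinable_letter (a : Γ) (i : ι) :
    UniformlyDefinable (wordLanguage Γ) (fun w : List Γ => Position w)
      fun w v => w[(v i : ℕ)]? = some a :=
  ⟨FirstOrder.Language.Relations.formula₁ (L := wordLanguage Γ)
      (show (wordLanguage Γ).Relations 1 from .letter a) (.var i),
    fun _ _ => FirstOrder.Language.Formula.realize_rel₁⟩

open UniformlyDefinable

theorem uniformlyDefinable_position_lt (i j : ι) :
    UniformlyDefinable (wordLanguage Γ) (fun w : List Γ => Position w) fun _ v => v i < v j :=
  (uniformlyDefinable_position_le j i).not.congr fun _ _ => not_le.symm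

theorem uniformlyDefinable_position_eq_zero (i : ι) :
    UniformlyDefinable (wordLanguage Γ) (fun w : List Γ => Position w) fun _ v => v i = 0 :=
  (all (P := fun _ v a => v i ≤ a) (uniformlyDefinable_position_le _ _)).congr fun _ _ =>
    ⟨fun h a => h ▸ Fin.zero_le a, fun h => Fin.le_zero_iff.1 (h 0)⟩

theorem uniformlyDefinable_position_eq_last (i : ι) :
    UniformlyDefinable (wordLanguage Γ) (fun w : List Γ => Position w)
      fun w v => v i = Fin.last w.length :=
  (all (P := fun _ v a => a ≤ v i) (uniformlyDefinable_position_le _ _)).congr fun _ _ =>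
    ⟨fun h a => h ▸ Fin.le_last a, fun h => le_antisymm (Fin.le_last _) (h _)⟩

/-- There is no symbol for 1; the successor is the least position strictly above. -/
theorem uniformlyDefinable_position_succ (i j : ι) :
    UniformlyDefinable (wordLanguage Γ) (fun w : List Γ => Position w)
      fun _ v => (v i : ℕ) + 1 = v j := by
  refine ((uniformlyDefinable_position_lt i j).and (all (P := fun _ v a => v i < a → v j ≤ a)
    ((uniformlyDefinable_position_lt _ _).imp (uniformlyDefinable_position_le _ _)))).congr
    fun w v => ⟨fun h => ⟨?_, fun a ha => ?_⟩, fun ⟨h, h'⟩ => ?_⟩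
  · rw [Fin.lt_def]; omega
  · rw [Fin.le_def]; rw [Fin.lt_def] at ha; omega
  · rw [Fin.lt_def] at h
    have := h' ⟨v i + 1, by omega⟩ (by rw [Fin.lt_def]; simp)
    rw [Fin.le_def] at this
    simp only at this
    omega

end Atoms

/-! ## Positive relevance in terms of valuations -/

section Semantics

variable {σ : Schema} {q : UCQNeg σ} {D : Database σ}

/-- The valuation `ν` satisfies `p` in `D`, where all facts whose absence is required are over the
active domain. -/
def CQNeg.SafeSat (D : Database σ) (p : CQNeg σ) (ν : Var → Const) : Prop :=
  (∀ a ∈ p.pos, a.eval ν ∈ D) ∧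
    (∀ a ∈ p.neg, (∀ i, (a.args i).eval ν ∈ activeDomain D) ∧ a.eval ν ∉ D) ∧
    ∀ e ∈ p.ineq, e.1.eval ν ≠ e.2.eval ν

theorem DBFact.plus_injective : Function.Injective (DBFact.plus (σ := σ)) := by
  rintro ⟨R, c⟩ ⟨S, d⟩ h
  obtain rfl : R = S := Sum.inl_injective (congrArg DBFact.rel h)
  exact congrArg (DBFact.mk R) (eq_of_heq ((DBFact.mk.injEq _ _ _ _).mp h).2)

theorem DBFact.minus_injective : Function.Injective (DBFact.minus (σ := σ)) := by
  rintro ⟨R, c⟩ ⟨S, d⟩ h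
  obtain rfl : R = S := Sum.inr_injective (congrArg DBFact.rel h)
  exact congrArg (DBFact.mk R) (eq_of_heq ((DBFact.mk.injEq _ _ _ _).mp h).2)

theorem DBFact.plus_ne_minus (f g : DBFact σ) : f.plus ≠ g.minus := fun h =>
  Sum.inl_ne_inr (congrArg DBFact.rel h)

theorem plus_mem_iff {A B : Set (DBFact σ)} {f : DBFact σ} :
    f.plus ∈ DBFact.plus '' A ∪ DBFact.minus '' B ↔ f ∈ A := by
  constructor
  · rintro (⟨g, hg, h⟩ | ⟨g, _, h⟩)
    · rwa [← DBFact.plus_injective h]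
    · exact (DBFact.plus_ne_minus _ _ h.symm).elim
  · exact fun h => Or.inl ⟨f, h, rfl⟩

theorem minus_mem_iff {A B : Set (DBFact σ)} {f : DBFact σ} :
    f.minus ∈ DBFact.plus '' A ∪ DBFact.minus '' B ↔ f ∈ B := by
  constructor
  · rintro (⟨g, _, h⟩ | ⟨g, hg, h⟩)
    · exact (DBFact.plus_ne_minus _ _ h).elim
    · rwa [← DBFact.minus_injective h]
  · exact fun h => Or.inr ⟨f, h, rfl⟩

/-- The signs keep the two kinds of atoms apart: `+` atoms are matched only in `S`, while `-` atoms
are matched in a set that depends on `D` alone. -/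
theorem isPositiveSupport_iff {S : Database σ} :
    IsPositiveSupport q D S ↔
      S ⊆ D ∧ ∃ p ∈ q, ∃ ν, p.SafeSat D ν ∧ ∀ a ∈ p.pos, a.eval ν ∈ S := by
  have hplus (a : Atom σ) (ν : Var → Const) : a.plus.eval ν = (a.eval ν).plus := rfl
  have hminus (a : Atom σ) (ν : Var → Const) : a.minus.eval ν = (a.eval ν).minus := rfl
  have hneg (f : DBFact σ) : f ∈ negPart (signedDatabase D) ↔
      (∀ i, f.args i ∈ activeDomain D) ∧ f ∉ D := minus_mem_iff
  refine and_congr_right fun hS => ?_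
  simp only [UCQNeg.Holds, UCQNeg.signed, List.mem_map, exists_exists_and_eq_and]
  refine exists_congr fun p => and_congr_right fun _ => exists_congr fun ν => ?_
  simp only [CQNeg.SatBy, CQNeg.signed, List.mem_append, List.mem_map, List.not_mem_nil,
    false_imp_iff, implies_true, true_and, CQNeg.SafeSat]
  constructor
  · rintro ⟨h, hi⟩
    have h1 : ∀ a ∈ p.pos, a.eval ν ∈ S := fun a ha =>
      plus_mem_iff.1 (h _ (Or.inl ⟨a, ha, rfl⟩))
    refine ⟨⟨fun a ha => hS (h1 a ha), fun a ha => ?_, hi⟩, h1⟩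
    exact (hneg _).1 ((minus_mem_iff (f := a.eval ν)).1 (h _ (Or.inr ⟨a, ha, rfl⟩)))
  · rintro ⟨⟨_, hn, hi⟩, h⟩
    refine ⟨?_, hi⟩
    rintro _ (⟨a, ha, rfl⟩ | ⟨a, ha, rfl⟩)
    · rw [hplus]
      exact plus_mem_iff.2 (h a ha)
    · rw [hminus]
      exact minus_mem_iff.2 ((hneg _).2 (hn a ha))

/-- Every support contains the image of the positive atoms under some good valuation, and that image
is itself a support. Hence minimal supports are images, and it suffices to test minimality against
other images. -/
theorem positiveRelevant_iff {α : DBFact σ} :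
    PositiveRelevant q D α ↔ ∃ p ∈ q, ∃ ν, p.SafeSat D ν ∧ (∃ a ∈ p.pos, a.eval ν = α) ∧
      ∀ p' ∈ q, ∀ ν', p'.SafeSat D ν' →
        (∀ a' ∈ p'.pos, ∃ a ∈ p.pos, a.eval ν = a'.eval ν') →
        ∀ a ∈ p.pos, ∃ a' ∈ p'.pos, a'.eval ν' = a.eval ν := by
  classical
  have image (p : CQNeg σ) (ν : Var → Const) (f : DBFact σ) :
      f ∈ (p.pos.map (Atom.eval ν)).toFinset ↔ ∃ a ∈ p.pos, a.eval ν = f := by simp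
  have support {p : CQNeg σ} (hp : p ∈ q) {ν : Var → Const} (h : p.SafeSat D ν) :
      IsPositiveSupport q D (p.pos.map (Atom.eval ν)).toFinset := by
    refine isPositiveSupport_iff.2 ⟨fun f hf => ?_, p, hp, ν, h, fun a ha =>
      (image _ _ _).2 ⟨a, ha, rfl⟩⟩
    obtain ⟨a, ha, rfl⟩ := (image _ _ _).1 hf
    exact h.1 a ha
  constructor
  · rintro ⟨S, hS, hα⟩
    obtain ⟨_, p, hp, ν, hν, hpS⟩ := isPositiveSupport_iff.1 hS.prop
    have h1 : (p.pos.map (Atom.eval ν)).toFinset ⊆ S := fun f hf => by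
      obtain ⟨a, ha, rfl⟩ := (image _ _ _).1 hf
      exact hpS a ha
    -- Minimality makes `S` equal to the image it contains.
    have h2 := hS.le_of_le (support hp hν) h1
    refine ⟨p, hp, ν, hν, (image _ _ _).1 (h2 hα), fun p' hp' ν' hν' hsub a ha => ?_⟩
    refine (image _ _ _).1 (hS.le_of_le (support hp' hν') (fun f hf => ?_) (hpS a ha))
    obtain ⟨a', ha', rfl⟩ := (image _ _ _).1 hf
    obtain ⟨a, ha, h⟩ := hsub a' ha'
    exact h ▸ hpS a ha
  · rintro ⟨p, hp, ν, hν, hα, hmin⟩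
    refine ⟨_, ⟨support hp hν, fun T hT hTS f hf => ?_⟩, (image _ _ _).2 hα⟩
    obtain ⟨_, p', hp', ν', hν', hpT⟩ := isPositiveSupport_iff.1 hT
    obtain ⟨a, ha, rfl⟩ := (image _ _ _).1 hf
    obtain ⟨a', ha', h⟩ := hmin p' hp' ν' hν'
      (fun a' ha' => (image _ _ _).1 (hTS (hpT a' ha'))) a ha
    exact h ▸ hpT a' ha'

/-! ### Safety and valuations by bounded tuples -/

theorem QTerm.eval_congr {t : QTerm} {ν ν' : Var → Const} (h : ∀ x, t = .var x → ν x = ν' x) :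
    t.eval ν = t.eval ν' := by
  cases t with
  | const c => rfl
  | var x => exact h x rfl

theorem Atom.eval_congr {a : Atom σ} {ν ν' : Var → Const} (h : ∀ x, a.HasVar x → ν x = ν' x) :
    a.eval ν = a.eval ν' := by
  simp only [Atom.eval, DBFact.mk.injEq, heq_eq_eq, true_and]
  exact funext fun i => QTerm.eval_congr fun x hx => h x ⟨i, hx⟩

/-- Safe negation: variables of negated atoms and inequalities already occur in positive atoms. -/
theorem CQNeg.SafeSat.congr {p : CQNeg σ} {ν ν' : Var → Const} (h : p.SafeSat D ν)
    (hν : ∀ a ∈ p.pos, ∀ x, a.HasVar x → ν x = ν' x) : p.SafeSat D ν' := by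
  obtain ⟨h1, h2, h3⟩ := h
  refine ⟨fun a ha => ?_, fun a ha => ?_, fun e he => ?_⟩
  · rw [← Atom.eval_congr (hν a ha)]
    exact h1 a ha
  · have key : ∀ x, a.HasVar x → ν x = ν' x := fun x hx => by
      obtain ⟨b, hb, hbx⟩ := p.safe_neg a ha x hx
      exact hν b hb x hbx
    rw [← Atom.eval_congr key]
    refine ⟨fun i => ?_, (h2 a ha).2⟩
    rw [← QTerm.eval_congr fun x hx => key x ⟨i, hx⟩]
    exact (h2 a ha).1 i
  · have key : ∀ x, e.1 = .var x ∨ e.2 = .var x → ν x = ν' x := fun x hx => by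
      obtain ⟨b, hb, hbx⟩ := p.safe_ineq e he x hx
      exact hν b hb x hbx
    rw [← QTerm.eval_congr fun x hx => key x (Or.inl hx),
      ← QTerm.eval_congr fun x hx => key x (Or.inr hx)]
    exact h3 e he

/-- The valuation given by a tuple of names of constants. -/
def valuation {M : Type} (dec : M → Const) {N : ℕ} (s : Fin (N + 1) → M) : Var → Const :=
  fun x => dec (s (Fin.ofNat (N + 1) x))

theorem exists_var_bound (q : UCQNeg σ) :
    ∃ N, ∀ p ∈ q, ∀ a ∈ p.pos, ∀ x, a.HasVar x → x ≤ N := by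
  have hfin : {x | ∃ p ∈ q, ∃ a ∈ p.pos, a.HasVar x}.Finite := by
    have h : {x | ∃ p ∈ q, ∃ a ∈ p.pos, a.HasVar x} =
        ⋃ p ∈ {p | p ∈ q}, ⋃ a ∈ {a | a ∈ p.pos}, ⋃ i, {x | a.args i = .var x} := by
      ext x
      simp [Atom.HasVar]
    rw [h]
    refine (List.finite_toSet q).biUnion fun p _ => (List.finite_toSet p.pos).biUnion fun a _ =>
      Set.finite_iUnion fun i => Set.Subsingleton.finite fun x hx y hy => ?_
    exact QTerm.var.inj (hx.symm.trans hy)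
  obtain ⟨N, hN⟩ := hfin.bddAbove
  exact ⟨N, fun p hp a ha x hx => hN ⟨p, hp, a, ha, hx⟩⟩

/-- A variable of a positive atom takes a value in the active domain, which has a name; any element
can stand for the other variables. -/
theorem CQNeg.SafeSat.exists_valuation {M : Type} [Nonempty M] {dec : M → Const}
    (hdec : activeDomain D ⊆ Set.range dec) {p : CQNeg σ} {ν : Var → Const} (h : p.SafeSat D ν)
    {N : ℕ} (hN : ∀ a ∈ p.pos, ∀ x, a.HasVar x → x ≤ N) :
    ∃ s : Fin (N + 1) → M, p.SafeSat D (valuation dec s) ∧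
      ∀ a ∈ p.pos, a.eval (valuation dec s) = a.eval ν := by
  classical
  let s : Fin (N + 1) → M := fun i =>
    if hi : ν i ∈ Set.range dec then hi.choose else Classical.arbitrary M
  have key : ∀ a ∈ p.pos, ∀ x, a.HasVar x → ν x = valuation dec s x := by
    rintro a ha x ⟨i, hi⟩
    -- `valuation` reduces variables modulo `N + 1`, which leaves those of positive atoms unchanged.
    have hx : x % (N + 1) = x := Nat.mod_eq_of_lt (Nat.lt_succ_of_le (hN a ha x ⟨i, hi⟩))
    have hmem : ν x ∈ Set.range dec := by
      refine hdec ⟨_, h.1 a ha, i, ?_⟩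
      simp only [Atom.eval, hi, QTerm.eval]
    have hmem' : ν (Fin.ofNat (N + 1) x) ∈ Set.range dec := by
      simpa only [Fin.val_ofNat, hx] using hmem
    have := hmem'.choose_spec
    simp only [valuation, s, dif_pos hmem']
    rw [this]
    simp only [Fin.val_ofNat, hx]
  exact ⟨s, h.congr key, fun a ha => (Atom.eval_congr (key a ha)).symm⟩

/-- The first-order form: valuations have become tuples of `N + 1` elements. A constant may have
several names, since only values under `dec` are compared. -/
theorem positiveRelevant_iff_valuation {M : Type} [Nonempty M] {dec : M → Const}
    (hdec : activeDomain D ⊆ Set.range dec) {N : ℕ}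
    (hN : ∀ p ∈ q, ∀ a ∈ p.pos, ∀ x, a.HasVar x → x ≤ N) {α : DBFact σ} :
    PositiveRelevant q D α ↔ ∃ p ∈ q, ∃ s : Fin (N + 1) → M, p.SafeSat D (valuation dec s) ∧
      (∃ a ∈ p.pos, a.eval (valuation dec s) = α) ∧
      ∀ p' ∈ q, ∀ s' : Fin (N + 1) → M, p'.SafeSat D (valuation dec s') →
        (∀ a' ∈ p'.pos, ∃ a ∈ p.pos, a.eval (valuation dec s) = a'.eval (valuation dec s')) →
        ∀ a ∈ p.pos, ∃ a' ∈ p'.pos, a'.eval (valuation dec s') = a.eval (valuation dec s) := by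
  rw [positiveRelevant_iff]
  refine exists_congr fun p => and_congr_right fun hp => ⟨?_, ?_⟩
  · rintro ⟨ν, hν, ⟨a, ha, hα⟩, hmin⟩
    obtain ⟨s, hs, hsν⟩ := hν.exists_valuation hdec (hN p hp)
    refine ⟨s, hs, ⟨a, ha, (hsν a ha).trans hα⟩, fun p' hp' s' hs' hsub b hb => ?_⟩
    rw [hsν b hb]
    refine hmin p' hp' _ hs' (fun a' ha' => ?_) b hb
    obtain ⟨a, ha, h⟩ := hsub a' ha'
    exact ⟨a, ha, (hsν a ha).symm.trans h⟩
  · rintro ⟨s, hs, hα, hmin⟩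
    refine ⟨_, hs, hα, fun p' hp' ν' hν' hsub b hb => ?_⟩
    obtain ⟨s', hs', hsν'⟩ := hν'.exists_valuation hdec (hN p' hp')
    obtain ⟨a', ha', h⟩ := hmin p' hp' s' hs' (fun a' ha' => by
      rw [hsν' a' ha']
      exact hsub a' ha') b hb
    exact ⟨a', ha', (hsν' a' ha').symm.trans h⟩

end Semantics

/-! ## Definability of positive relevance -/

section Definability

open UniformlyDefinable

variable {σ : Schema} {L : FirstOrder.Language.{0, 0}} {X : Type} {M : X → Type}
  [∀ x, L.Structure (M x)] {D : X → Database σ} {dec : ∀ x, M x → Const} {ι : Type} {N : ℕ}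

/-- Two selections `f` and `g` of variables are allowed because minimality compares two valuations.
-/
theorem uniformlyDefinable_eval_eq
    (heq : UniformlyDefinable L M fun x (v : Fin 2 → M x) => dec x (v 0) = dec x (v 1))
    (f g : Fin (N + 1) → ι) {t u : QTerm}
    (ht : ∀ c, t = .const c → UniformlyDefinable L M fun x (v : Unit → M x) => dec x (v ()) = c)
    (hu : ∀ c, u = .const c → UniformlyDefinable L M fun x (v : Unit → M x) => dec x (v ()) = c) :
    UniformlyDefinable L M fun x (v : ι → M x) =>
      t.eval (valuation (dec x) fun i => v (f i)) =
        u.eval (valuation (dec x) fun i => v (g i)) := by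
  cases t with
  | const c =>
    cases u with
    | const d => exact const (c = d)
    | var y =>
      exact ((ht c rfl).reindex fun _ => g (Fin.ofNat (N + 1) y)).congr fun _ _ => eq_comm
  | var y =>
    cases u with
    | const d => exact (hu d rfl).reindex fun _ => f (Fin.ofNat (N + 1) y)
    | var z => exact heq.reindex ![f (Fin.ofNat (N + 1) y), g (Fin.ofNat (N + 1) z)]

theorem uniformlyDefinable_name_eq_eval
    (heq : UniformlyDefinable L M fun x (v : Fin 2 → M x) => dec x (v 0) = dec x (v 1))
    (j : ι) (g : Fin (N + 1) → ι) {u : QTerm}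
    (hu : ∀ c, u = .const c → UniformlyDefinable L M fun x (v : Unit → M x) => dec x (v ()) = c) :
    UniformlyDefinable L M fun x (v : ι → M x) =>
      dec x (v j) = u.eval (valuation (dec x) fun i => v (g i)) := by
  cases u with
  | const d => exact (hu d rfl).reindex fun _ => j
  | var z => exact heq.reindex ![j, g (Fin.ofNat (N + 1) z)]

theorem uniformlyDefinable_atom_eq
    (heq : UniformlyDefinable L M fun x (v : Fin 2 → M x) => dec x (v 0) = dec x (v 1))
    (f g : Fin (N + 1) → ι) {a b : Atom σ}
    (ha : ∀ i c, a.args i = .const c →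
      UniformlyDefinable L M fun x (v : Unit → M x) => dec x (v ()) = c)
    (hb : ∀ i c, b.args i = .const c →
      UniformlyDefinable L M fun x (v : Unit → M x) => dec x (v ()) = c) :
    UniformlyDefinable L M fun x (v : ι → M x) =>
      a.eval (valuation (dec x) fun i => v (f i)) =
        b.eval (valuation (dec x) fun i => v (g i)) := by
  obtain ⟨R, t⟩ := a
  obtain ⟨S, u⟩ := b
  by_cases h : R = S
  · subst h
    exact (forallFinite fun i => uniformlyDefinable_eval_eq heq f g (ha i) (hb i)).congr
      fun x v => by simp [Atom.eval, funext_iff]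
  · exact (const False).congr fun x v => by simp [Atom.eval, h]

theorem uniformlyDefinable_atom_eq_fact
    (heq : UniformlyDefinable L M fun x (v : Fin 2 → M x) => dec x (v 0) = dec x (v 1))
    (f : Fin (N + 1) → ι) (R : σ.Rel) (y : Fin (σ.arity R) → ι) {a : Atom σ}
    (ha : ∀ i c, a.args i = .const c →
      UniformlyDefinable L M fun x (v : Unit → M x) => dec x (v ()) = c) :
    UniformlyDefinable L M fun x (v : ι → M x) =>
      a.eval (valuation (dec x) fun i => v (f i)) = ⟨R, fun i => dec x (v (y i))⟩ := by
  obtain ⟨S, t⟩ := a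
  by_cases h : S = R
  · subst h
    exact (forallFinite fun i => uniformlyDefinable_name_eq_eval heq (y i) f (ha i)).congr
      fun x v => by simp [Atom.eval, funext_iff, eq_comm]
  · exact (const False).congr fun x v => by simp [Atom.eval, h]

theorem uniformlyDefinable_atom_mem (hdec : ∀ x, activeDomain (D x) ⊆ Set.range (dec x))
    (heq : UniformlyDefinable L M fun x (v : Fin 2 → M x) => dec x (v 0) = dec x (v 1))
    (hmem : ∀ R, UniformlyDefinable L M fun x (v : Fin (σ.arity R) → M x) =>
      (⟨R, fun i => dec x (v i)⟩ : DBFact σ) ∈ D x)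
    (f : Fin (N + 1) → ι) {a : Atom σ}
    (ha : ∀ i c, a.args i = .const c →
      UniformlyDefinable L M fun x (v : Unit → M x) => dec x (v ()) = c) :
    UniformlyDefinable L M fun x (v : ι → M x) =>
      a.eval (valuation (dec x) fun i => v (f i)) ∈ D x := by
  -- `hmem` speaks of tuples of names, whereas the atom may contain query constants, so names `u` of
  -- its arguments are guessed. They exist if the fact is in the database; an argument without a
  -- name makes both sides false.
  refine (exTuple (κ := Fin (σ.arity a.rel)) (P := fun x v u =>
    (⟨a.rel, fun i => dec x (u i)⟩ : DBFact σ) ∈ D x ∧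
      ∀ i, dec x (u i) = (a.args i).eval (valuation (dec x) fun i => v (f i)))
    (((hmem a.rel).reindex Sum.inr).and (forallFinite fun i =>
      uniformlyDefinable_name_eq_eval heq (Sum.inr i) (fun i => Sum.inl (f i)) (ha i)))).congr
    fun x v => ⟨fun h => ?_, ?_⟩
  · choose u hu using fun i => hdec x ⟨_, h, i, rfl⟩
    refine ⟨u, ?_, hu⟩
    rw [show (⟨a.rel, fun i => dec x (u i)⟩ : DBFact σ) = a.eval _ from
      congrArg (DBFact.mk a.rel) (funext hu)]
    exact h
  · rintro ⟨u, hu, h⟩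
    rwa [show (fun i => dec x (u i)) = _ from funext h] at hu

theorem uniformlyDefinable_eval_mem_activeDomain
    (hdec : ∀ x, activeDomain (D x) ⊆ Set.range (dec x))
    (heq : UniformlyDefinable L M fun x (v : Fin 2 → M x) => dec x (v 0) = dec x (v 1))
    (hmem : ∀ R, UniformlyDefinable L M fun x (v : Fin (σ.arity R) → M x) =>
      (⟨R, fun i => dec x (v i)⟩ : DBFact σ) ∈ D x)
    (f : Fin (N + 1) → ι) {t : QTerm}
    (ht : ∀ c, t = .const c → UniformlyDefinable L M fun x (v : Unit → M x) => dec x (v ()) = c) :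
    UniformlyDefinable L M fun x (v : ι → M x) =>
      t.eval (valuation (dec x) fun i => v (f i)) ∈ activeDomain (D x) := by
  have := σ.finite_rel
  refine (existsFinite fun R : σ.Rel => existsFinite fun i : Fin (σ.arity R) =>
    exTuple (κ := Fin (σ.arity R)) (P := fun x v u =>
      (⟨R, fun i => dec x (u i)⟩ : DBFact σ) ∈ D x ∧
        dec x (u i) = t.eval (valuation (dec x) fun i => v (f i)))
    (((hmem R).reindex Sum.inr).and
      (uniformlyDefinable_name_eq_eval heq (Sum.inr i) (fun i => Sum.inl (f i)) ht))).congr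
    fun x v => ⟨?_, ?_⟩
  · rintro ⟨⟨R, c⟩, hc, i, hi⟩
    choose u hu using fun i => hdec x ⟨_, hc, i, rfl⟩
    refine ⟨R, i, u, ?_, (hu i).trans hi⟩
    rw [show (⟨R, fun i => dec x (u i)⟩ : DBFact σ) = ⟨R, c⟩ from
      congrArg (DBFact.mk R) (funext hu)]
    exact hc
  · rintro ⟨R, i, u, hu, h⟩
    exact ⟨_, hu, i, h⟩

theorem uniformlyDefinable_safeSat (hdec : ∀ x, activeDomain (D x) ⊆ Set.range (dec x))
    (heq : UniformlyDefinable L M fun x (v : Fin 2 → M x) => dec x (v 0) = dec x (v 1))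
    (hmem : ∀ R, UniformlyDefinable L M fun x (v : Fin (σ.arity R) → M x) =>
      (⟨R, fun i => dec x (v i)⟩ : DBFact σ) ∈ D x)
    {q : UCQNeg σ} (hconst : ∀ c ∈ q.consts,
      UniformlyDefinable L M fun x (v : Unit → M x) => dec x (v ()) = c)
    {p : CQNeg σ} (hp : p ∈ q) (f : Fin (N + 1) → ι) :
    UniformlyDefinable L M fun x (v : ι → M x) =>
      p.SafeSat (D x) (valuation (dec x) fun i => v (f i)) := by
  refine (forallMem _ fun a ha => ?_).and ((forallMem _ fun a ha => ?_).and
    (forallMem _ fun e he => ?_))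
  · exact uniformlyDefinable_atom_mem hdec heq hmem f fun i c h =>
      hconst c ⟨p, hp, Or.inl ⟨a, ha, i, h⟩⟩
  · have key : ∀ i c, a.args i = .const c → _ := fun i c h =>
      hconst c ⟨p, hp, Or.inr (Or.inl ⟨a, ha, i, h⟩)⟩
    exact (forallFinite fun i => uniformlyDefinable_eval_mem_activeDomain hdec heq hmem f
      (key i)).and (uniformlyDefinable_atom_mem hdec heq hmem f key).not
  · exact (uniformlyDefinable_eval_eq heq f f
      (fun c h => hconst c ⟨p, hp, Or.inr (Or.inr ⟨e, he, Or.inl h⟩)⟩)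
      fun c h => hconst c ⟨p, hp, Or.inr (Or.inr ⟨e, he, Or.inr h⟩)⟩).not

/-- Positive relevance is first-order definable in every family of structures in which databases
are first-order interpreted. -/
theorem uniformlyDefinable_positiveRelevant [∀ x, Nonempty (M x)]
    (hdec : ∀ x, activeDomain (D x) ⊆ Set.range (dec x))
    (heq : UniformlyDefinable L M fun x (v : Fin 2 → M x) => dec x (v 0) = dec x (v 1))
    (hmem : ∀ R, UniformlyDefinable L M fun x (v : Fin (σ.arity R) → M x) =>
      (⟨R, fun i => dec x (v i)⟩ : DBFact σ) ∈ D x)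
    {q : UCQNeg σ} (hconst : ∀ c ∈ q.consts,
      UniformlyDefinable L M fun x (v : Unit → M x) => dec x (v ()) = c) (R : σ.Rel) :
    UniformlyDefinable L M fun x (v : Fin (σ.arity R) → M x) =>
      PositiveRelevant q (D x) ⟨R, fun i => dec x (v i)⟩ := by
  obtain ⟨N, hN⟩ := exists_var_bound q
  have key {p : CQNeg σ} (hp : p ∈ q) {a : Atom σ} (ha : a ∈ p.pos) :
      ∀ i c, a.args i = .const c → _ := fun i c h => hconst c ⟨p, hp, Or.inl ⟨a, ha, i, h⟩⟩
  refine UniformlyDefinable.congr ?_ fun x v => positiveRelevant_iff_valuation (hdec x) hN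
  refine existsMem q fun p hp => exTuple ?_
  refine (uniformlyDefinable_safeSat hdec heq hmem hconst hp Sum.inr).and
    ((existsMem _ fun a ha => uniformlyDefinable_atom_eq_fact heq _ _ _ (key hp ha)).and
    (forallMem q fun p' hp' => allTuple ?_))
  refine (uniformlyDefinable_safeSat hdec heq hmem hconst hp' Sum.inr).imp (imp ?_ ?_)
  · exact forallMem _ fun a' ha' => existsMem _ fun a ha =>
      uniformlyDefinable_atom_eq heq (fun i => Sum.inl (Sum.inr i)) _ (key hp ha) (key hp' ha')
  · exact forallMem _ fun a ha => existsMem _ fun a' ha' =>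
      uniformlyDefinable_atom_eq heq _ (fun i => Sum.inl (Sum.inr i)) (key hp' ha') (key hp ha)

end Definability

/-- Positive relevance is first-order definable over databases. -/
theorem exists_formula_positiveRelevant (σ : Schema) (q : UCQNeg σ) (R : σ.Rel) :
    ∃ φ : (schemaLanguage σ q.consts).Formula (Fin (σ.arity R)),
      ∀ (D : Database σ) (α : DBFact σ) (hα : α ∈ D) (h : α.rel = R),
        φ.Realize (fun i => factArgs q.consts hα (Fin.cast (congrArg σ.arity h.symm) i)) ↔
          PositiveRelevant q D α := by
  -- The domain is empty for the empty database and a query without constants. A database with a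
  -- fact is never excluded, as arities are positive.
  let X := {D : Database σ // Nonempty (EvalDomain D q.consts)}
  have hne (x : X) : Nonempty (EvalDomain x.1 q.consts) := x.2
  obtain ⟨φ, hφ⟩ := uniformlyDefinable_positiveRelevant (L := schemaLanguage σ q.consts) (X := X)
    (M := fun x => EvalDomain x.1 q.consts) (D := fun x => x.1) (dec := fun x c => c.1)
    (q := q) (fun x c hc => ⟨⟨c, Or.inl hc⟩, rfl⟩)
    ((UniformlyDefinable.eq 0 1).congr fun x v => Subtype.ext_iff.symm)
    (fun R => ⟨FirstOrder.Language.Relations.formula (L := schemaLanguage σ q.consts)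
      (show (schemaLanguage σ q.consts).Relations (σ.arity R) from ⟨R, rfl⟩) fun i => .var i,
      fun x v => FirstOrder.Language.Formula.realize_rel⟩)
    (fun c hc => ⟨(FirstOrder.Language.Term.var ()).equal
      (FirstOrder.Language.Constants.term (L := schemaLanguage σ q.consts)
        (show (schemaLanguage σ q.consts).Functions 0 from ⟨⟨c, hc⟩, rfl⟩)), fun x v =>
      FirstOrder.Language.Formula.realize_equal.trans Subtype.ext_iff⟩) R
  refine ⟨φ, ?_⟩
  rintro D ⟨R, c⟩ hα rfl
  exact hφ ⟨D, ⟨factArgs q.consts hα ⟨0, σ.arity_pos R⟩⟩⟩ _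

/-! ## Words that represent databases -/

section Words

variable {σ : Schema}

theorem drop_eq_cons_of_getElem? {Γ : Type} {w : List Γ} {i : ℕ} {a : Γ} (h : w[i]? = some a) :
    w.drop i = a :: w.drop (i + 1) := by
  obtain ⟨hi, rfl⟩ := List.getElem?_eq_some_iff.1 h
  exact List.drop_eq_getElem_cons hi

theorem getElem?_of_drop_eq_append {Γ : Type} {w l l' : List Γ} {i j : ℕ}
    (h : w.drop i = l ++ l') (hj : j < l.length) : w[i + j]? = l[j]? := by
  rw [← List.getElem?_drop, h, List.getElem?_append_left hj]

theorem drop_add_of_drop_eq_append {Γ : Type} {w l l' : List Γ} {i : ℕ}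
    (h : w.drop i = l ++ l') : w.drop (i + l.length) = l' := by
  rw [← List.drop_drop, h, List.drop_left]

theorem add_length_le_of_drop_eq_append {Γ : Type} {w l l' : List Γ} {i : ℕ}
    (h : w.drop i = l ++ l') (hi : i ≤ w.length) : i + l.length ≤ w.length := by
  have := congrArg List.length h
  rw [List.length_drop, List.length_append] at this
  omega

/-- The constant whose bits are the longest initial sequence of bits of a word. -/
def decodeBits : List (DBSymbol σ) → Const
  | Sum.inl (some b) :: l => b :: decodeBits l
  | _ => []

@[simp]
theorem decodeBits_encodeConst_append (c : Const) (l : List (DBSymbol σ)) :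
    decodeBits (encodeConst σ c ++ l) = c := by
  induction c with
  | nil => rfl
  | cons b c ih => exact congrArg (b :: ·) ih

theorem length_encodeConst (c : Const) : (encodeConst σ c).length = c.length + 1 := by
  simp [encodeConst]

/-- Turns the recursive decoding into a condition on single letters, which a first-order formula can
express. -/
theorem getElem?_decodeBits (l : List (DBSymbol σ)) (d : ℕ) (b : Bool) :
    (decodeBits l)[d]? = some b ↔ l[d]? = some (Sum.inl (some b)) ∧
      ∀ d' < d, ∃ b', l[d']? = some (Sum.inl (some b')) := by
  induction l generalizing d with
  | nil => simp [decodeBits]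
  | cons a l ih =>
    rcases a with (_ | b') | R
    · cases d with
      | zero => simp [decodeBits]
      | succ d => simpa [decodeBits] using fun _ => ⟨0, by simp⟩
    · cases d with
      | zero => simp [decodeBits]
      | succ d =>
        rw [decodeBits, List.getElem?_cons_succ, List.getElem?_cons_succ, ih]
        refine and_congr_right fun _ => ⟨fun h d' hd' => ?_, fun h d' hd' => ?_⟩
        · cases d' with
          | zero => exact ⟨b', rfl⟩
          | succ d' => exact h d' (by omega)
        · exact h (d' + 1) (by omega)
    · cases d with
      | zero => simp [decodeBits]
      | succ d => simpa [decodeBits] using fun _ => ⟨0, by simp⟩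

/-- The constant that starts at a position of a word. -/
def constAt (w : List (DBSymbol σ)) (i : Position w) : Const := decodeBits (w.drop i)

/-- Constants are compared bit by bit at equal offsets. Offsets beyond the length of the word reach
no letter, so offsets can range over positions. -/
theorem constAt_eq_iff {w : List (DBSymbol σ)} {i j : Position w} :
    constAt w i = constAt w j ↔ ∀ d : Position w, ∀ b : Bool,
      (w[(i + d : ℕ)]? = some (Sum.inl (some b)) ∧
        ∀ d' : Position w, d' < d → ∃ b', w[(i + d' : ℕ)]? = some (Sum.inl (some b'))) ↔
      (w[(j + d : ℕ)]? = some (Sum.inl (some b)) ∧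
        ∀ d' : Position w, d' < d → ∃ b', w[(j + d' : ℕ)]? = some (Sum.inl (some b'))) := by
  have key (i d : Position w) (b : Bool) : (constAt w i)[(d : ℕ)]? = some b ↔
      w[(i + d : ℕ)]? = some (Sum.inl (some b)) ∧
        ∀ d' : Position w, d' < d → ∃ b', w[(i + d' : ℕ)]? = some (Sum.inl (some b')) := by
    simp only [constAt, getElem?_decodeBits, List.getElem?_drop]
    exact and_congr_right fun _ => ⟨fun h d' hd' => h d' hd',
      fun h d' hd' => h ⟨d', hd'.trans d.2⟩ hd'⟩
  simp only [← key]
  refine ⟨fun h d b => by rw [h], fun h => List.ext_getElem? fun d => Option.ext fun b => ?_⟩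
  by_cases hd : d < w.length + 1
  · exact h ⟨d, hd⟩ b
  · simp only [constAt, getElem?_decodeBits, List.getElem?_drop]
    have hi : w[(i + d : ℕ)]? = none := List.getElem?_eq_none (by omega)
    have hj : w[(j + d : ℕ)]? = none := List.getElem?_eq_none (by omega)
    simp [hi, hj]

/-- The letters from position `a` up to position `b` are the encoding of a constant. -/
def ConstSegment (w : List (DBSymbol σ)) (a b : Position w) : Prop :=
  ∃ e : Position w, (e : ℕ) + 1 = b ∧ a ≤ e ∧ w[(e : ℕ)]? = some (Sum.inl none) ∧
    ∀ j : Position w, a ≤ j → j < e → ∃ b : Bool, w[(j : ℕ)]? = some (Sum.inl (some b))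

theorem constSegment_iff {w : List (DBSymbol σ)} {a b : Position w} :
    ConstSegment w a b ↔ w.drop a = encodeConst σ (constAt w a) ++ w.drop b := by
  constructor
  · rintro ⟨e, heb, hae, he, hj⟩
    -- Induction on the distance to the end marker at `e`.
    have key (d : ℕ) : ∀ a : ℕ, a + d = e →
        (∀ j : Position w, a ≤ j → j < e → ∃ b : Bool, w[(j : ℕ)]? = some (Sum.inl (some b))) →
        ∃ c, w.drop a = encodeConst σ c ++ w.drop b := by
      induction d with
      | zero =>
        intro a ha _
        obtain rfl : a = e := ha
        exact ⟨[], by rw [drop_eq_cons_of_getElem? he, heb]; rfl⟩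
      | succ d ih =>
        intro a ha hj
        obtain ⟨c, hc⟩ := ih (a + 1) (by omega) fun j h => hj j (by omega)
        obtain ⟨b', hb⟩ := hj ⟨a, by omega⟩ le_rfl (by rw [Fin.lt_def]; simp only; omega)
        exact ⟨b' :: c, by rw [drop_eq_cons_of_getElem? hb, hc]; rfl⟩
    obtain ⟨c, hc⟩ := key (e - a) a (Nat.add_sub_of_le hae) hj
    rw [constAt, hc, decodeBits_encodeConst_append]
  · intro h
    generalize constAt w a = c at h
    have hlen := congrArg List.length h
    have hb := b.2
    have ha := a.2
    rw [List.length_append, List.length_drop, List.length_drop, length_encodeConst] at hlen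
    refine ⟨⟨a + c.length, by omega⟩, ?_, ?_, ?_, fun j haj hj => ?_⟩
    · simp only
      omega
    · rw [Fin.le_def]
      simp
    · simp only
      rw [getElem?_of_drop_eq_append h (by simp [encodeConst])]
      simp [encodeConst]
    · rw [Fin.le_def] at haj
      rw [Fin.lt_def] at hj
      simp only at hj
      obtain ⟨d, hd⟩ := Nat.exists_eq_add_of_le haj
      have hdc : d < c.length := by omega
      rw [hd, getElem?_of_drop_eq_append h (by rw [length_encodeConst]; omega)]
      refine ⟨List.get c ⟨d, hdc⟩, ?_⟩
      rw [encodeConst, List.getElem?_append_left (by simpa using hdc), List.getElem?_map,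
        List.getElem?_eq_getElem hdc]
      rfl

theorem drop_eq_flatMap_encodeConst {w : List (DBSymbol σ)} {k : ℕ} {c : Fin k → Const}
    {e : Fin (k + 1) → ℕ}
    (h : ∀ m : Fin k, w.drop (e m.castSucc) = encodeConst σ (c m) ++ w.drop (e m.succ)) :
    w.drop (e 0) = (List.ofFn c).flatMap (encodeConst σ) ++ w.drop (e (Fin.last k)) := by
  induction k with
  | zero => simp
  | succ k ih =>
    rw [List.ofFn_succ, List.flatMap_cons, List.append_assoc]
    have h0 := h 0
    rw [Fin.castSucc_zero] at h0
    rw [h0]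
    congr 1
    exact ih (c := fun m => c m.succ) (e := fun m => e m.succ) fun m => h m.succ

/-- Converse of `drop_eq_flatMap_encodeConst`: the `k + 1` cut points between consecutive constants
are the positions a formula can quantify over. -/
theorem exists_segments {w : List (DBSymbol σ)} {k : ℕ} {c : Fin k → Const} {a : Position w}
    {l : List (DBSymbol σ)} (h : w.drop a = (List.ofFn c).flatMap (encodeConst σ) ++ l) :
    ∃ e : Fin (k + 1) → Position w, e 0 = a ∧ w.drop (e (Fin.last k)) = l ∧
      ∀ m : Fin k, w.drop (e m.castSucc) = encodeConst σ (c m) ++ w.drop (e m.succ) := by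
  induction k generalizing a with
  | zero => exact ⟨fun _ => a, rfl, by simpa using h, fun m => m.elim0⟩
  | succ k ih =>
    rw [List.ofFn_succ, List.flatMap_cons, List.append_assoc] at h
    have hle := add_length_le_of_drop_eq_append h (Nat.le_of_lt_succ a.2)
    have h' := drop_add_of_drop_eq_append h
    obtain ⟨e, he0, hel, he⟩ := ih (c := fun m => c m.succ) (a := ⟨_, Nat.lt_succ_of_le hle⟩) h'
    refine ⟨Fin.cons a e, rfl, hel, fun m => ?_⟩
    refine Fin.cases ?_ (fun m => ?_) m
    · rw [Fin.castSucc_zero, Fin.cons_zero, Fin.cons_succ, he0, h]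
      congr 1
      exact h'.symm
    · rw [← Fin.succ_castSucc, Fin.cons_succ, Fin.cons_succ]
      exact he m

/-- The end marker tells where the first constant stops, so `decodeBits` recovers it whatever
follows. -/
theorem flatMap_encodeConst_injective {r r' : List (DBSymbol σ)} {k : ℕ} {c d : Fin k → Const}
    (h : (List.ofFn c).flatMap (encodeConst σ) ++ r = (List.ofFn d).flatMap (encodeConst σ) ++ r') :
    c = d := by
  induction k with
  | zero => exact Subsingleton.elim _ _
  | succ k ih =>
    rw [List.ofFn_succ, List.flatMap_cons, List.append_assoc, List.ofFn_succ, List.flatMap_cons,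
      List.append_assoc] at h
    have h0 : c 0 = d 0 := by simpa using congrArg decodeBits h
    rw [h0] at h
    have ht := ih (c := fun m => c m.succ) (d := fun m => d m.succ) (List.append_cancel_left h)
    funext m
    exact Fin.cases h0 (fun m => congrFun ht m) m

/-- The leading relation symbol fixes how many constants are to be read. -/
theorem encodeFact_prefix_free {f g : DBFact σ} {r r' : List (DBSymbol σ)}
    (h : encodeFact f ++ r = encodeFact g ++ r') : f = g := by
  obtain ⟨R, c⟩ := f
  obtain ⟨S, d⟩ := g
  obtain ⟨h1, h2⟩ := List.cons.inj h
  obtain rfl : R = S := Sum.inr_injective h1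
  exact congrArg (DBFact.mk R) (flatMap_encodeConst_injective h2)

/-- A fact of the relation `R` is written at position `i`, its arguments being the constants that
start at the positions `v`. -/
def FactAt (w : List (DBSymbol σ)) (R : σ.Rel) (i : Position w)
    (v : Fin (σ.arity R) → Position w) : Prop :=
  w[(i : ℕ)]? = some (Sum.inr R) ∧ ∃ e : Fin (σ.arity R + 1) → Position w, (i : ℕ) + 1 = e 0 ∧
    ∀ m : Fin (σ.arity R), ConstSegment w (e m.castSucc) (e m.succ) ∧
      constAt w (e m.castSucc) = constAt w (v m)

/-- The cut points `e` lie inside the written fact, while the names `v` may point to any occurrences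
of the same constants. -/
theorem factAt_iff {w : List (DBSymbol σ)} {R : σ.Rel} {i : Position w}
    {v : Fin (σ.arity R) → Position w} :
    FactAt w R i v ↔ ∃ r, w.drop i = encodeFact ⟨R, fun m => constAt w (v m)⟩ ++ r := by
  constructor
  · rintro ⟨hi, e, he0, he⟩
    refine ⟨w.drop (e (Fin.last _)), ?_⟩
    rw [drop_eq_cons_of_getElem? hi, he0, drop_eq_flatMap_encodeConst
      (c := fun m => constAt w (v m)) (e := fun m => (e m : ℕ)) fun m => ?_]
    · rfl
    · rw [← (he m).2]
      exact constSegment_iff.1 (he m).1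
  · rintro ⟨r, hr⟩
    have hi : w[(i : ℕ)]? = some (Sum.inr R) :=
      getElem?_of_drop_eq_append (j := 0) hr (by simp [encodeFact])
    have hlt : (i : ℕ) < w.length := (List.getElem?_eq_some_iff.1 hi).1
    rw [drop_eq_cons_of_getElem? hi] at hr
    obtain ⟨e, he0, _, he⟩ := exists_segments (a := ⟨i + 1, by omega⟩) (List.cons.inj hr).2
    have hc (m : Fin (σ.arity R)) : constAt w (e m.castSucc) = constAt w (v m) := by
      rw [constAt, he, decodeBits_encodeConst_append]
    refine ⟨hi, e, by rw [he0], fun m => ⟨?_, hc m⟩⟩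
    rw [constSegment_iff, hc]
    exact he m

/-- The relation symbols in a sequence of facts are where the facts start. -/
theorem exists_split_of_getElem? {l : List (DBFact σ)} {i : ℕ} {R : σ.Rel}
    (h : (l.flatMap encodeFact)[i]? = some (Sum.inr R)) :
    ∃ l₁ f l₂, l = l₁ ++ f :: l₂ ∧ i = (l₁.flatMap encodeFact).length ∧ f.rel = R := by
  induction l generalizing i with
  | nil => simp at h
  | cons g l ih =>
    rw [List.flatMap_cons] at h
    by_cases hi : i < (encodeFact g).length
    · rw [List.getElem?_append_left hi] at h
      cases i with
      | zero => exact ⟨[], g, l, rfl, rfl, Sum.inr_injective (Option.some.inj h)⟩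
      | succ i =>
        -- After its first letter, a written fact contains only bits and end markers.
        have := List.mem_of_getElem?
          (show ((List.ofFn g.args).flatMap (encodeConst σ))[i]? = _ from h)
        simp [encodeConst] at this
    · rw [List.getElem?_append_right (not_lt.1 hi)] at h
      obtain ⟨l₁, f, l₂, rfl, h1, h2⟩ := ih h
      refine ⟨g :: l₁, f, l₂, rfl, ?_, h2⟩
      rw [List.flatMap_cons, List.length_append, ← h1]
      omega

/-- The word that represents a fact and a list of facts. -/
def instanceWord (x : DBFact σ × List (DBFact σ)) : List (DBSymbol σ) :=
  (x.1 :: x.2).flatMap encodeFact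

theorem drop_length_flatMap_encodeFact (l₁ l₂ : List (DBFact σ)) :
    ((l₁ ++ l₂).flatMap encodeFact).drop (l₁.flatMap encodeFact).length =
      l₂.flatMap encodeFact := by
  rw [List.flatMap_append, List.drop_left]

/-- Position 0 carries the queried fact, which precedes the list and does not count as an entry. At
any other position, a written fact starts with a relation symbol, hence at the start of an entry,
and prefix-freeness identifies the two. -/
theorem mem_iff_exists_drop_eq {x : DBFact σ × List (DBFact σ)} {f : DBFact σ} :
    f ∈ x.2 ↔ ∃ i : Position (instanceWord x), i ≠ 0 ∧
      ∃ r, (instanceWord x).drop i = encodeFact f ++ r := by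
  obtain ⟨α, l⟩ := x
  constructor
  · intro h
    obtain ⟨l₁, l₂, rfl⟩ := List.append_of_mem h
    refine ⟨⟨((α :: l₁).flatMap encodeFact).length, ?_⟩, ?_, l₂.flatMap encodeFact, ?_⟩
    · simp only [instanceWord, List.flatMap_cons, List.flatMap_append, List.length_append]
      omega
    · simp [Fin.ext_iff, encodeFact]
    · exact drop_length_flatMap_encodeFact (α :: l₁) (f :: l₂)
  · rintro ⟨i, hi, r, hr⟩
    have h1 : (instanceWord (α, l))[(i : ℕ)]? = some (Sum.inr f.rel) :=
      getElem?_of_drop_eq_append (j := 0) hr (by simp [encodeFact])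
    obtain ⟨l₁, g, l₂, hl, hil, -⟩ := exists_split_of_getElem? h1
    simp only [instanceWord] at hr
    rw [hil, hl, drop_length_flatMap_encodeFact, List.flatMap_cons] at hr
    obtain rfl := encodeFact_prefix_free hr
    cases l₁ with
    | nil => exact (hi (Fin.ext hil)).elim
    | cons α' l₁ =>
      obtain ⟨-, rfl⟩ := List.cons.inj hl
      simp

/-- The letters of a word form a nonempty sequence of facts. -/
def IsInstanceWord (w : List (DBSymbol σ)) : Prop :=
  (∃ R : σ.Rel, w[0]? = some (Sum.inr R)) ∧
    ∀ R : σ.Rel, ∀ i : Position w, w[(i : ℕ)]? = some (Sum.inr R) →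
      ∃ e : Fin (σ.arity R + 1) → Position w, (i : ℕ) + 1 = e 0 ∧
        (∀ m : Fin (σ.arity R), ConstSegment w (e m.castSucc) (e m.succ)) ∧
        (e (Fin.last _) = Fin.last w.length ∨
          ∃ S : σ.Rel, w[(e (Fin.last _) : ℕ)]? = some (Sum.inr S))

/-- The local conditions chain: each fact ends where the word ends or where another relation symbol
starts the next fact, so parsing never gets stuck. -/
theorem isInstanceWord_iff {w : List (DBSymbol σ)} :
    IsInstanceWord w ↔ ∃ x, w = instanceWord x := by
  constructor
  · rintro ⟨⟨R₀, hR₀⟩, h⟩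
    -- Induction on a bound for the number of unread letters. Comparing lengths shows that the last
    -- cut point lies beyond `i`.
    have key (d : ℕ) : ∀ i : Position w, w.length - i ≤ d →
        (i = Fin.last w.length ∨ ∃ R : σ.Rel, w[(i : ℕ)]? = some (Sum.inr R)) →
        ∃ l : List (DBFact σ), w.drop i = l.flatMap encodeFact := by
      induction d with
      | zero =>
        intro i hd _
        exact ⟨[], by rw [List.drop_eq_nil_of_le (by omega)]; rfl⟩
      | succ d ih =>
        rintro i hd (rfl | ⟨R, hR⟩)
        · exact ⟨[], by simp⟩
        · obtain ⟨e, he0, he, hlast⟩ := h R i hR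
          have hdrop := drop_eq_flatMap_encodeConst (e := fun m => (e m : ℕ))
            fun m => constSegment_iff.1 (he m)
          have hlen := congrArg List.length hdrop
          have := (e (Fin.last _)).2
          have := (e 0).2
          rw [List.length_append, List.length_drop, List.length_drop] at hlen
          obtain ⟨l, hl⟩ := ih (e (Fin.last _)) (by omega) hlast
          refine ⟨⟨R, fun m => constAt w (e m.castSucc)⟩ :: l, ?_⟩
          rw [drop_eq_cons_of_getElem? hR, he0, hdrop, hl]
          rfl
    obtain ⟨l, hl⟩ := key w.length 0 (Nat.sub_le _ _) (Or.inr ⟨R₀, hR₀⟩)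
    have hl : w = l.flatMap encodeFact := hl
    cases l with
    | nil => simp [hl] at hR₀
    | cons α l => exact ⟨(α, l), hl⟩
  · rintro ⟨⟨α, l⟩, rfl⟩
    refine ⟨⟨α.rel, rfl⟩, fun R i hR => ?_⟩
    obtain ⟨l₁, f, l₂, hl, hi, rfl⟩ := exists_split_of_getElem? hR
    have hdrop : (instanceWord (α, l)).drop i = encodeFact f ++ l₂.flatMap encodeFact := by
      simp only [instanceWord]
      rw [hi, hl, drop_length_flatMap_encodeFact, List.flatMap_cons]
    rw [drop_eq_cons_of_getElem? hR] at hdrop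
    have hlt : (i : ℕ) < (instanceWord (α, l)).length := (List.getElem?_eq_some_iff.1 hR).1
    obtain ⟨e, he0, hel, he⟩ := exists_segments (a := ⟨i + 1, by omega⟩) (List.cons.inj hdrop).2
    refine ⟨e, by rw [he0], fun m => ?_, ?_⟩
    · rw [constSegment_iff, constAt, he, decodeBits_encodeConst_append]
    · cases l₂ with
      | nil =>
        left
        have := List.drop_eq_nil_iff.1 hel
        exact le_antisymm (Fin.le_last _) this
      | cons g l₂ =>
        exact Or.inr ⟨g.rel, getElem?_of_drop_eq_append (l := encodeFact g) (j := 0)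
          hel (by simp [encodeFact])⟩

end Words

/-! ### First-order definability of the encoding -/

section WordDefinability

open UniformlyDefinable

variable {σ : Schema} {ι : Type}

/-- If the sum carries a letter it is a position, so it may be quantified over. -/
theorem uniformlyDefinable_letter_add (a : DBSymbol σ) (i d : ι) :
    UniformlyDefinable (wordLanguage (DBSymbol σ)) (fun w : List (DBSymbol σ) => Position w)
      fun w v => w[(v i + v d : ℕ)]? = some a := by
  refine (ex (P := fun w v (z : Position w) => (v i : ℕ) + v d = z ∧ w[(z : ℕ)]? = some a)
    ((uniformlyDefinable_position_add _ _ _).and (uniformlyDefinable_letter _ _))).congr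
    fun w v => ⟨fun h => ?_, ?_⟩
  · have := (List.getElem?_eq_some_iff.1 h).1
    exact ⟨⟨v i + v d, by omega⟩, rfl, h⟩
  · rintro ⟨z, hz, h⟩
    rwa [hz]

theorem uniformlyDefinable_constAt_eq (i j : ι) :
    UniformlyDefinable (wordLanguage (DBSymbol σ)) (fun w : List (DBSymbol σ) => Position w)
      fun w v => constAt w (v i) = constAt w (v j) := by
  refine UniformlyDefinable.congr ?_ fun w v => constAt_eq_iff
  refine all (forallFinite fun b => iff ?_ ?_) <;>
  exact (uniformlyDefinable_letter_add _ _ _).and (all ((uniformlyDefinable_position_lt _ _).imp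
    (existsFinite fun _ => uniformlyDefinable_letter_add _ _ _)))

theorem uniformlyDefinable_constAt_eq_const (c : Const) (i : ι) :
    UniformlyDefinable (wordLanguage (DBSymbol σ)) (fun w : List (DBSymbol σ) => Position w)
      fun w v => constAt w (v i) = c := by
  induction c generalizing ι with
  | nil =>
    refine (existsFinite fun b : Bool =>
      uniformlyDefinable_letter (Sum.inl (some b) : DBSymbol σ) i).not.congr fun w v => ?_
    rw [constAt]
    by_cases h : (v i : ℕ) < w.length
    · rw [List.drop_eq_getElem_cons h, List.getElem?_eq_getElem h]
      rcases w[(v i : ℕ)] with (_ | b) | R <;> simp [decodeBits]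
    · rw [List.drop_eq_nil_of_le (not_lt.1 h), List.getElem?_eq_none (not_lt.1 h)]
      simp [decodeBits]
  | cons b c ih =>
    refine ((uniformlyDefinable_letter (Sum.inl (some b) : DBSymbol σ) i).and
      (ex (P := fun w v (z : Position w) => (v i : ℕ) + 1 = z ∧ constAt w z = c)
        ((uniformlyDefinable_position_succ _ _).and (ih _)))).congr fun w v => ?_
    simp only [constAt]
    by_cases h : (v i : ℕ) < w.length
    · have hz : (∃ z : Position w, (v i : ℕ) + 1 = z ∧ decodeBits (w.drop z) = c) ↔
          decodeBits (w.drop (v i + 1)) = c := by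
        constructor
        · rintro ⟨z, hz, h⟩
          rwa [hz]
        · exact fun h' => ⟨⟨v i + 1, by omega⟩, rfl, h'⟩
      rw [hz, List.drop_eq_getElem_cons h, List.getElem?_eq_getElem h]
      rcases w[(v i : ℕ)] with (_ | b) | R <;> simp [decodeBits]
    · rw [List.drop_eq_nil_of_le (not_lt.1 h), List.getElem?_eq_none (not_lt.1 h)]
      simp [decodeBits]

theorem uniformlyDefinable_constSegment (i j : ι) :
    UniformlyDefinable (wordLanguage (DBSymbol σ)) (fun w : List (DBSymbol σ) => Position w)
      fun w v => ConstSegment w (v i) (v j) :=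
  ex ((uniformlyDefinable_position_succ _ _).and ((uniformlyDefinable_position_le _ _).and
    ((uniformlyDefinable_letter _ _).and (all ((uniformlyDefinable_position_le _ _).imp
      ((uniformlyDefinable_position_lt _ _).imp
        (existsFinite fun _ => uniformlyDefinable_letter _ _)))))))

theorem uniformlyDefinable_factAt (R : σ.Rel) (i : ι) (f : Fin (σ.arity R) → ι) :
    UniformlyDefinable (wordLanguage (DBSymbol σ)) (fun w : List (DBSymbol σ) => Position w)
      fun w v => FactAt w R (v i) fun m => v (f m) :=
  (uniformlyDefinable_letter _ _).and (exTuple ((uniformlyDefinable_position_succ _ _).and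
    (forallFinite fun _ => (uniformlyDefinable_constSegment _ _).and
      (uniformlyDefinable_constAt_eq _ _))))

theorem uniformlyDefinable_isInstanceWord :
    UniformlyDefinable (wordLanguage (DBSymbol σ)) (fun w : List (DBSymbol σ) => Position w)
      fun w (_ : ι → Position w) => IsInstanceWord w := by
  have := σ.finite_rel
  refine UniformlyDefinable.and (existsFinite fun R => ?_) (forallFinite fun R => all ?_)
  · refine (ex (P := fun w _ (z : Position w) => z = 0 ∧ w[(z : ℕ)]? = some (Sum.inr R))
      ((uniformlyDefinable_position_eq_zero _).and (uniformlyDefinable_letter _ _))).congr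
      fun w v => ⟨fun h => ⟨0, rfl, h⟩, ?_⟩
    rintro ⟨z, rfl, h⟩
    exact h
  · exact (uniformlyDefinable_letter _ _).imp (exTuple ((uniformlyDefinable_position_succ _ _).and
      ((forallFinite fun _ => uniformlyDefinable_constSegment _ _).and
        ((uniformlyDefinable_position_eq_last _).or
          (existsFinite fun S => uniformlyDefinable_letter _ _)))))

open Classical in
theorem uniformlyDefinable_positiveRelevant_instanceWord (q : UCQNeg σ) :
    UniformlyDefinable (wordLanguage (DBSymbol σ))
      (fun x : DBFact σ × List (DBFact σ) => Position (instanceWord x))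
      fun x (_ : Empty → Position (instanceWord x)) =>
        x.1 ∈ x.2 ∧ PositiveRelevant q x.2.toFinset x.1 := by
  have := σ.finite_rel
  let D : DBFact σ × List (DBFact σ) → Database σ := fun x => x.2.toFinset
  let dec : ∀ x : DBFact σ × List (DBFact σ), Position (instanceWord x) → Const :=
    fun x => constAt (instanceWord x)
  -- The arguments of a written fact are named by the positions at which they are written.
  have hname (x : DBFact σ × List (DBFact σ)) (f : DBFact σ) (i : Position (instanceWord x))
      (r : List (DBSymbol σ)) (h : (instanceWord x).drop i = encodeFact f ++ r) :
      ∃ v : Fin (σ.arity f.rel) → Position (instanceWord x), f.args = fun m => dec x (v m) := by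
    have hi : (instanceWord x)[(i : ℕ)]? = some (Sum.inr f.rel) :=
      getElem?_of_drop_eq_append (j := 0) h (by simp [encodeFact])
    have hlt : (i : ℕ) < (instanceWord x).length := (List.getElem?_eq_some_iff.1 hi).1
    rw [drop_eq_cons_of_getElem? hi] at h
    obtain ⟨e, -, -, he⟩ := exists_segments (a := ⟨i + 1, by omega⟩) (List.cons.inj h).2
    refine ⟨fun m => e m.castSucc, funext fun m => ?_⟩
    simp only [dec]
    rw [constAt, he, decodeBits_encodeConst_append]
  have hdec : ∀ x, activeDomain (D x) ⊆ Set.range (dec x) := by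
    rintro x _ ⟨f, hf, i, rfl⟩
    obtain ⟨j, -, r, hr⟩ := mem_iff_exists_drop_eq.1 (List.mem_toFinset.1 hf)
    obtain ⟨v, hv⟩ := hname x f j r hr
    exact ⟨v i, by rw [hv]⟩
  have hmem (R : σ.Rel) : UniformlyDefinable (wordLanguage (DBSymbol σ))
      (fun x : DBFact σ × List (DBFact σ) => Position (instanceWord x))
      fun x (v : Fin (σ.arity R) → Position (instanceWord x)) =>
        (⟨R, fun i => dec x (v i)⟩ : DBFact σ) ∈ D x := by
    refine (UniformlyDefinable.pullback (ex (P := fun w v i => ¬ i = 0 ∧ FactAt w R i v)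
      ((uniformlyDefinable_position_eq_zero _).not.and (uniformlyDefinable_factAt _ _ _)))
      instanceWord).congr fun x v => ?_
    rw [List.mem_toFinset, mem_iff_exists_drop_eq]
    exact exists_congr fun i => and_congr_right fun _ => factAt_iff.symm
  have hrel := uniformlyDefinable_positiveRelevant (D := D) (dec := dec) (q := q) hdec
    ((uniformlyDefinable_constAt_eq 0 1).pullback instanceWord) hmem
    (fun c _ => (uniformlyDefinable_constAt_eq_const c ()).pullback instanceWord)
  have hfirst (R : σ.Rel) := UniformlyDefinable.pullback (Y := DBFact σ × List (DBFact σ))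
    (ex (P := fun w (v : Fin (σ.arity R) → Position w) i => i = 0 ∧ FactAt w R i v)
      ((uniformlyDefinable_position_eq_zero _).and (uniformlyDefinable_factAt _ _ _))) instanceWord
  -- The formula guesses the relation symbol and names for the arguments of the fact at position 0;
  -- by prefix-freeness this fact is `x.1`.
  refine (existsFinite fun R : σ.Rel => exTuple (κ := Fin (σ.arity R)) (P := fun x _ v =>
      (∃ i : Position (instanceWord x), i = 0 ∧ FactAt (instanceWord x) R i v) ∧
        (⟨R, fun i => dec x (v i)⟩ : DBFact σ) ∈ D x ∧
        PositiveRelevant q (D x) ⟨R, fun i => dec x (v i)⟩)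
    (UniformlyDefinable.reindex ((hfirst R).and ((hmem R).and (hrel R))) Sum.inr)).congr
    fun x _ => ?_
  have h0 : (instanceWord x).drop (0 : Position (instanceWord x)) =
      encodeFact x.1 ++ x.2.flatMap encodeFact := rfl
  constructor
  · rintro ⟨h, h'⟩
    obtain ⟨v, hv⟩ := hname x x.1 0 _ h0
    have hx : x.1 = ⟨x.1.rel, fun m => dec x (v m)⟩ := congrArg (DBFact.mk x.1.rel) hv
    refine ⟨x.1.rel, v, ⟨0, rfl, factAt_iff.2 ⟨x.2.flatMap encodeFact, ?_⟩⟩, ?_, ?_⟩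
    · exact h0.trans (congrArg (fun f => encodeFact f ++ _) hx)
    · rw [← hx]
      exact List.mem_toFinset.2 h
    · rwa [← hx]
  · rintro ⟨R, v, ⟨_, rfl, hv⟩, h, h'⟩
    obtain ⟨r, hr⟩ := factAt_iff.1 hv
    have hx : x.1 = ⟨R, fun m => dec x (v m)⟩ := encodeFact_prefix_free (h0.symm.trans hr)
    rw [← hx] at h h'
    exact ⟨List.mem_toFinset.1 h, h'⟩

/-! ### The relevance problem in uniform `AC⁰` -/

open Classical in
theorem mem_relevanceLanguage_iff {q : UCQNeg σ} {w : List (DBSymbol σ)} :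
    w ∈ relevanceLanguage q ↔
      ∃ x, w = instanceWord x ∧ x.1 ∈ x.2 ∧ PositiveRelevant q x.2.toFinset x.1 := by
  constructor
  · rintro ⟨D, α, ⟨l, hl, rfl⟩, hα, h⟩
    obtain rfl : D = l.toFinset := by
      ext f
      rw [List.mem_toFinset, hl]
    exact ⟨(α, l), rfl, (hl α).2 hα, h⟩
  · rintro ⟨⟨α, l⟩, rfl, hα, h⟩
    exact ⟨l.toFinset, α, ⟨l, fun f => List.mem_toFinset.symm, rfl⟩, List.mem_toFinset.2 hα, h⟩

theorem inAC0_relevanceLanguage (q : UCQNeg σ) : InAC0 (relevanceLanguage q) := by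
  refine inAC0_of_uniformlyDefinable ?_
  obtain ⟨φ, hφ⟩ := uniformlyDefinable_positiveRelevant_instanceWord q
  refine ((uniformlyDefinable_isInstanceWord (ι := Empty)).and
    -- `φ` is known to be correct only on instance words. On other words its truth value is
    -- irrelevant, as `IsInstanceWord` fails there.
    ⟨φ, fun w v => Iff.rfl⟩).congr fun w v => ?_
  rw [mem_relevanceLanguage_iff]
  constructor
  · rintro ⟨x, rfl, h⟩
    exact ⟨isInstanceWord_iff.2 ⟨x, rfl⟩, (hφ x v).2 h⟩
  · rintro ⟨h, h'⟩
    obtain ⟨x, rfl⟩ := isInstanceWord_iff.1 h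
    exact ⟨x, rfl, (hφ x v).1 h'⟩

end WordDefinability

theorem mainTheorem7 (σ : Schema) (q : UCQNeg σ) :
    (∃ φ : ∀ R : σ.Rel, (schemaLanguage σ q.consts).Formula (Fin (σ.arity R)),
      ∀ (D : Database σ) (α : DBFact σ) (hα : α ∈ D),
        (φ α.rel).Realize (factArgs q.consts hα) ↔ PositiveRelevant q D α) ∧
    InAC0 (relevanceLanguage q) := by
  choose φ hφ using exists_formula_positiveRelevant σ q
  exact ⟨⟨φ, fun D α hα => hφ α.rel D α hα rfl⟩, inAC0_relevanceLanguage q⟩
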